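/- Notation. All logarithms are natural; $\|\cdot\|$ is the Euclidean norm. For $s>0$ let $\mathcal N_{\mathbb Z}(0,s^2)$ be the distribution on $\mathbb Z$ with mass at $x$ proportional to $e^{-x^2/(2s^2)}$. Let $d$ be a power of $2$ and let $H_d$ be the Walsh–Hadamard matrix, $H_1=(1)$, $H_{2d}=\frac1{\sqrt2}\begin{pmatrix}H_d&H_d\\H_d&-H_d\end{pmatrix}$. Given a modulus $m\in\mathbb N$ and parameters $c,\gamma,\sigma>0$, $\beta\in[0,1)$, the system $\tilde A$ acts on $x=(x_1,\dots,x_n)\in(\mathbb R^d)^n$ as follows. (Shared randomness) A uniformly random $\xi\in\{-1,1\}^d$ is drawn, and $D_\xi=\mathrm{diag}(\xi)$. (Client $i$) Put $x_i''=H_dD_\xi\cdot\frac1\gamma\min\{1,c/\|x_i\|\}\,x_i$. Let $\tilde x_i\in\mathbb Z^d$ have the law of the randomized rounding of $x_i''$ (independent coordinates, mean $x_i''$, each coordinate of $\tilde x_i-x_i''$ in $(-1,1)$) conditioned on $$\|\tilde x_i\|\le\min\Big\{\tfrac c\gamma+\sqrt d,\ \sqrt{\tfrac{c^2}{\gamma^2}+\tfrac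 d4+\sqrt{2\log(1/\beta)}\,\big(\tfrac c\gamma+\tfrac{\sqrt d}2\big)}\Big\}$$ (for $\beta=0$ the second term is $+\infty$). Let $y_i\in\mathbb Z^d$ have independent $\mathcal N_{\mathbb Z}(0,\sigma^2/\gamma^2)$ coordinates, and output $z_i=(\tilde x_i+y_i)\bmod m$. Given $\xi$, the clients' random choices are independent. (Server) Secure aggregation reveals only $\sum_i z_i\bmod m$. Let $\bar z'$ be its coordinatewise representative in $(-m/2,m/2]$. The output is $\tilde A(x)=\gamma D_\xi H_d^T\bar z'\in\mathbb R^d$. Privacy. For discrete distributions $P,Q$ and $\alpha>1$ let $D_\alpha(P\|Q)=\frac1{\alpha-1}\log\mathbb E_{Y\leftarrow P}\big[(P(Y)/Q(Y))^{\alpha-1}\big]$ (and $+\infty$ if $P\not\ll Q$). $\tilde A$ is $\frac12\varepsilon^2$-concentrated differentially private (CDP) if $\sup_{\alpha>1}\frac1\alpha D_\alpha(\tilde A(x)\|\tilde A(x'))\le\frac12\varepsilon^2$ for all $x,x'\in(\mathbb R^d)^n$ one of which arises from the other by replacing one entry by the zero vector (addition or removal of one person, with $n$ kept fixed). Theorem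 (Accuracy of the algorithm). There are universal constants $p\in\mathbb N$ and $A>0$ and, for every $K>0$, a constant $C>0$ depending only on $K$, such that the following holds. Let $n\ge1$, let $d$ be a power of $2$, let $m\in\mathbb N$ and $c,\varepsilon>0$, put $X=n+\sqrt{\varepsilon^2n^3/d}+\sqrt d/\varepsilon$, and suppose that $m=\tilde\Omega(X)$ in the sense that $$m\ \ge\ A\,X\,\big(\log(2+X)\big)^p .$$ Then there are $\gamma,\sigma>0$ with $$\gamma=\tilde\Theta\Big(\frac{cn}{m\sqrt d}+\frac c{\varepsilon m}\Big),\qquad \sigma=\tilde\Theta\Big(\frac c{\varepsilon\sqrt n}+\sqrt{\frac dn}\cdot\frac\gamma\varepsilon\Big),$$ where $f=\tilde\Theta(g)$ means that $f\le A(\log(2+m))^p\,g$ and $g\le A(\log(2+m))^p\,f$, such that for every $\beta\in[0,\frac12]$ with $\beta\le K\min\{\sqrt{\gamma/n},\,1/n\}$ the system $\tilde A$ with parameters $m,c,\gamma,\sigma,\beta$ 1. is $\frac12\varepsilon^2$-CDP, and 2. satisfies, for all $x_1,\dots,x_n\in\mathbb R^d$ with $\|x_i\|\le c$ for all $i$,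 $$\mathbb E\Big[\Big\|\tilde A(x)-\sum_{i=1}^nx_i\Big\|^2\Big]\ \le\ C\,\frac{c^2d}{\varepsilon^2}.$$ -/

import Mathlib

open scoped ENNReal Matrix

noncomputable section

namespace SecSum

/-! ### Discrete probability -/

theorem tsum_prod_fin {α : Type*} :
    ∀ {n : ℕ} (p : Fin n → PMF α), ∑' f : Fin n → α, ∏ i, p i (f i) = 1
  | 0, p => by simp
  | n + 1, p => by
    rw [← (Fin.consEquiv fun _ : Fin (n + 1) => α).tsum_eq, ENNReal.tsum_prod']
    have h : ∀ (a : α) (f : Fin n → α),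
        ∏ i, p i ((Fin.consEquiv fun _ : Fin (n + 1) => α) (a, f) i)
          = p 0 a * ∏ i, p i.succ (f i) := by
      intro a f
      rw [Fin.prod_univ_succ]
      simp [Fin.consEquiv]
    simp_rw [h, ENNReal.tsum_mul_left, tsum_prod_fin fun i : Fin n => p i.succ, mul_one]
    exact (p 0).tsum_coe

/-- The law of a tuple of independent random variables, the `i`-th one distributed as `p i`. -/
def independent {α : Type*} {n : ℕ} (p : Fin n → PMF α) : PMF (Fin n → α) :=
  ⟨fun f => ∏ i, p i (f i), ENNReal.summable.hasSum_iff.2 (tsum_prod_fin p)⟩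

/-- The unnormalised weight `exp (-x² / (2 s²))` of the discrete Gaussian at the integer `x`. -/
def gaussianWeight (s : ℝ) (x : ℤ) : ℝ≥0∞ :=
  ENNReal.ofReal (Real.exp (-(x : ℝ) ^ 2 / (2 * s ^ 2)))

theorem tsum_gaussianWeight_ne_zero (s : ℝ) : ∑' x, gaussianWeight s x ≠ 0 := by
  intro h
  have h0 := ENNReal.tsum_eq_zero.1 h 0
  simp [gaussianWeight] at h0

theorem tsum_gaussianWeight_ne_top {s : ℝ} (hs : 0 < s) : ∑' x, gaussianWeight s x ≠ ∞ := by
  have hT : 0 < 1 / (2 * Real.pi * s ^ 2) := by positivity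
  have hsum := summable_pow_mul_jacobiTheta₂_term_bound 0 hT 0
  have hs' : Summable fun x : ℤ => Real.exp (-(x : ℝ) ^ 2 / (2 * s ^ 2)) := by
    refine hsum.congr fun x => ?_
    have : Real.pi ≠ 0 := Real.pi_ne_zero
    simp only [pow_zero, one_mul]
    congr 1
    field_simp
    ring
  unfold gaussianWeight
  rw [← ENNReal.ofReal_tsum_of_nonneg (fun x => (Real.exp_pos _).le) hs']
  exact ENNReal.ofReal_ne_top

/-- The discrete Gaussian `N_ℤ(0, s²)` on the integers. -/
def discreteGaussian (s : ℝ) (hs : 0 < s) : PMF ℤ :=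
  PMF.normalize (gaussianWeight s) (tsum_gaussianWeight_ne_zero s) (tsum_gaussianWeight_ne_top hs)

/-- Randomized rounding of the real number `t`: it takes the value `⌊t⌋ + 1` with probability
`t - ⌊t⌋` and the value `⌊t⌋` otherwise. -/
def roundCoord (t : ℝ) : PMF ℤ :=
  PMF.ofFinset
    (fun w => if w = ⌊t⌋ then ENNReal.ofReal (1 - Int.fract t)
      else if w = ⌊t⌋ + 1 then ENNReal.ofReal (Int.fract t) else 0)
    {⌊t⌋, ⌊t⌋ + 1}
    (by
      rw [Finset.sum_pair (by simp)]
      simp only [if_true, add_eq_left, one_ne_zero, if_false]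
      rw [← ENNReal.ofReal_add (by linarith [Int.fract_lt_one t]) (Int.fract_nonneg t)]
      simp)
    (by
      intro a ha
      simp only [Finset.mem_insert, Finset.mem_singleton, not_or] at ha
      simp [ha.1, ha.2])

/-- Randomized rounding of a vector: the coordinates are rounded independently. -/
def roundVec {d : ℕ} (u : EuclideanSpace ℝ (Fin d)) : PMF (Fin d → ℤ) :=
  independent fun j => roundCoord (u j)

/-- An integer vector as an element of Euclidean space. -/
def intVec {d : ℕ} (w : Fin d → ℤ) : EuclideanSpace ℝ (Fin d) :=
  WithLp.toLp 2 fun j => (w j : ℝ)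

/-- The integer vectors `w` with
`‖w‖ ≤ min {r + √d, √(r² + d/4 + √(2 log (1/β)) (r + √d/2))}`.
For `β = 0` the second bound is `+∞` and only the first one counts. -/
def accepted (d : ℕ) (r β : ℝ) : Set (Fin d → ℤ) :=
  {w | ‖intVec w‖ ≤ r + √(d : ℝ) ∧
    (β ≠ 0 → ‖intVec w‖ ≤
      √(r ^ 2 + (d : ℝ) / 4 + √(2 * Real.log (1 / β)) * (r + √(d : ℝ) / 2)))}

/-- Every real number has a possible rounding `w` with `|w - t| ≤ 1` and `w² ≤ t² + 1/4`. -/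
theorem exists_roundCoord (t : ℝ) :
    ∃ w ∈ (roundCoord t).support, |(w : ℝ) - t| ≤ 1 ∧ (w : ℝ) ^ 2 ≤ t ^ 2 + 1 / 4 := by
  have hf0 := Int.fract_nonneg t
  have hf1 := Int.fract_lt_one t
  have ht : t = ⌊t⌋ + Int.fract t := (Int.floor_add_fract t).symm
  by_cases h : ((⌊t⌋ : ℝ)) ^ 2 ≤ t ^ 2 + 1 / 4
  · refine ⟨⌊t⌋, ?_, ?_, h⟩
    · rw [roundCoord, PMF.mem_support_ofFinset_iff]
      simp [hf1]
    · rw [abs_le]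
      constructor <;> linarith
  · refine ⟨⌊t⌋ + 1, ?_, ?_, ?_⟩
    · rw [roundCoord, PMF.mem_support_ofFinset_iff]
      have hpos : 0 < Int.fract t := by
        rcases hf0.lt_or_eq with h' | h'
        · exact h'
        · exact absurd (by rw [← h', add_zero] at ht; rw [← ht]; linarith) h
      simp only [Finset.mem_insert, Finset.mem_singleton, or_true, true_and, add_eq_left,
        one_ne_zero, if_false, if_true, ne_eq, ENNReal.ofReal_eq_zero, not_le]
      exact hpos
    · push_cast
      rw [abs_le]
      constructor <;> linarith
    · push_cast
      generalize (⌊t⌋ : ℝ) = a at *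
      generalize Int.fract t = f at *
      subst ht
      -- the mean of the squares of the two values is at most `t² + 1/4`
      have hm : (1 - f) * a ^ 2 + f * (a + 1) ^ 2 ≤ (a + f) ^ 2 + 1 / 4 := by
        nlinarith [sq_nonneg (f - 1 / 2)]
      push Not at h
      by_contra h2
      push Not at h2
      nlinarith [mul_lt_mul_of_pos_left h (by linarith : 0 < 1 - f),
        mul_le_mul_of_nonneg_left h2.le hf0]

/-- A vector of norm at most `r` has a possible rounding that is accepted. -/
theorem exists_accepted {d : ℕ} {r : ℝ} (β : ℝ) (u : EuclideanSpace ℝ (Fin d)) (hu : ‖u‖ ≤ r) :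
    ∃ w ∈ accepted d r β, w ∈ (roundVec u).support := by
  have hr : 0 ≤ r := (norm_nonneg u).trans hu
  choose w hw h1 h2 using fun j => exists_roundCoord (u j)
  refine ⟨w, ⟨?_, fun _ => ?_⟩, ?_⟩
  · have hd : ‖intVec w - u‖ ≤ √(d : ℝ) := by
      rw [EuclideanSpace.norm_eq]
      apply Real.sqrt_le_sqrt
      calc ∑ j, ‖(intVec w - u) j‖ ^ 2 ≤ ∑ _j : Fin d, (1 : ℝ) := by
            refine Finset.sum_le_sum fun j _ => ?_
            have : ‖(intVec w - u) j‖ ≤ 1 := by simpa [intVec] using h1 j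
            nlinarith [norm_nonneg ((intVec w - u) j)]
        _ = d := by simp
    calc ‖intVec w‖ = ‖u + (intVec w - u)‖ := by congr 1; abel
      _ ≤ ‖u‖ + ‖intVec w - u‖ := norm_add_le _ _
      _ ≤ r + √(d : ℝ) := add_le_add hu hd
  · apply Real.le_sqrt_of_sq_le
    have hsq : ‖intVec w‖ ^ 2 ≤ ‖u‖ ^ 2 + (d : ℝ) / 4 := by
      rw [EuclideanSpace.norm_sq_eq, EuclideanSpace.norm_sq_eq]
      calc ∑ j, ‖intVec w j‖ ^ 2 ≤ ∑ j : Fin d, (‖u j‖ ^ 2 + 1 / 4) := by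
            refine Finset.sum_le_sum fun j _ => ?_
            simpa [intVec] using h2 j
        _ = ∑ j, ‖u j‖ ^ 2 + (d : ℝ) / 4 := by
            rw [Finset.sum_add_distrib]; simp; ring
    have h3 : 0 ≤ √(2 * Real.log (1 / β)) * (r + √(d : ℝ) / 2) := by positivity
    have h4 : ‖u‖ ^ 2 ≤ r ^ 2 := pow_le_pow_left₀ (norm_nonneg u) hu 2
    linarith
  · rw [PMF.mem_support_iff]
    change ∏ j, roundCoord (u j) (w j) ≠ 0
    exact Finset.prod_ne_zero_iff.2 fun j _ => (PMF.mem_support_iff _ _).1 (hw j)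

/-- Conditional randomized rounding of a vector `u` of norm at most `r`: randomized rounding is
repeated until the result is accepted; that is, randomized rounding conditioned on acceptance. -/
def condRound {d : ℕ} (r β : ℝ) (u : EuclideanSpace ℝ (Fin d)) (hu : ‖u‖ ≤ r) :
    PMF (Fin d → ℤ) :=
  (roundVec u).filter (accepted d r β) (exists_accepted β u hu)

/-! ### Flattening -/

/-- The Walsh-Hadamard matrices: `H₁ = (1)` and `H_{2d} = (1/√2) [[H_d, H_d], [H_d, -H_d]]`. -/
def walshHadamard : (k : ℕ) → Matrix (Fin (2 ^ k)) (Fin (2 ^ k)) ℝ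
  | 0 => 1
  | k + 1 =>
    let H := walshHadamard k
    let e : Fin (2 ^ k) ⊕ Fin (2 ^ k) ≃ Fin (2 ^ (k + 1)) :=
      finSumFinEquiv.trans (finCongr (by rw [pow_succ, mul_two]))
    (1 / √2 : ℝ) • Matrix.reindex e e (Matrix.fromBlocks H H H (-H))

theorem walshHadamard_transpose_mul_self (k : ℕ) :
    (walshHadamard k)ᵀ * walshHadamard k = 1 := by
  induction k with
  | zero => simp [walshHadamard]
  | succ k ih =>
    have h2 : (1 / √2 : ℝ) * (1 / √2) = 1 / 2 := by
      rw [div_mul_div_comm, Real.mul_self_sqrt (by norm_num)]; norm_num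
    simp only [walshHadamard, Matrix.transpose_smul, Matrix.smul_mul, Matrix.mul_smul, smul_smul,
      h2, Matrix.reindex_apply, Matrix.transpose_submatrix, Matrix.submatrix_mul_equiv,
      Matrix.fromBlocks_transpose, Matrix.fromBlocks_multiply, Matrix.transpose_neg,
      Matrix.mul_neg, Matrix.neg_mul, neg_neg, ih, add_neg_cancel]
    have h1 : (1 : Matrix (Fin (2 ^ k)) (Fin (2 ^ k)) ℝ) + 1 = (2 : ℝ) • 1 := by
      rw [two_smul]
    have h3 : Matrix.fromBlocks ((1 : Matrix (Fin (2 ^ k)) (Fin (2 ^ k)) ℝ) + 1) 0 0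
          ((1 : Matrix (Fin (2 ^ k)) (Fin (2 ^ k)) ℝ) + 1)
        = (2 : ℝ) • 1 := by
      rw [h1, ← Matrix.fromBlocks_one, Matrix.fromBlocks_smul, smul_zero]
    rw [h3]
    change (1 / 2 : ℝ) • ((2 : ℝ) • (1 : Matrix (Fin (2 ^ k) ⊕ Fin (2 ^ k))
      (Fin (2 ^ k) ⊕ Fin (2 ^ k)) ℝ).submatrix _ _) = 1
    rw [Matrix.submatrix_one_equiv, smul_smul]
    norm_num

/-- The diagonal matrix with the signs `ξ` on the diagonal. -/
def signMatrix {d : ℕ} (ξ : Fin d → ℤˣ) : Matrix (Fin d) (Fin d) ℝ :=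
  Matrix.diagonal fun j => ((ξ j : ℤ) : ℝ)

/-- The flattening matrix `H_d D_ξ`, where `d = 2 ^ k`. -/
def flatten {k : ℕ} (ξ : Fin (2 ^ k) → ℤˣ) : Matrix (Fin (2 ^ k)) (Fin (2 ^ k)) ℝ :=
  walshHadamard k * signMatrix ξ

theorem flatten_transpose_mul_self {k : ℕ} (ξ : Fin (2 ^ k) → ℤˣ) :
    (flatten ξ)ᵀ * flatten ξ = 1 := by
  have hD : (signMatrix ξ)ᵀ * signMatrix ξ = 1 := by
    rw [signMatrix, Matrix.diagonal_transpose, Matrix.diagonal_mul_diagonal, ← Matrix.diagonal_one]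
    congr 1
    funext j
    rcases Int.units_eq_one_or (ξ j) with h | h <;> simp [h]
  rw [flatten, Matrix.transpose_mul, Matrix.mul_assoc, ← Matrix.mul_assoc _ (walshHadamard k),
    walshHadamard_transpose_mul_self, Matrix.one_mul, hD]

/-! ### The algorithm -/

/-- The parameters: modulus `m`, clipping threshold `c`, granularity `γ`, noise scale `σ` and
bias `β`. -/
structure Params where
  m : ℕ
  c : ℝ
  γ : ℝ
  σ : ℝ
  β : ℝ
  c_pos : 0 < c
  γ_pos : 0 < γ
  σ_pos : 0 < σ
  β_nonneg : 0 ≤ β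
  β_lt_one : β < 1

/-- Clip and rescale: `(1/γ) min {1, c / ‖x‖} x` (which is `0` for `x = 0`). -/
def clip {d : ℕ} (P : Params) (x : EuclideanSpace ℝ (Fin d)) : EuclideanSpace ℝ (Fin d) :=
  (1 / P.γ * min 1 (P.c / ‖x‖)) • x

/-- Flatten: `H_d D_ξ` applied to the clipped and rescaled vector. -/
def flatClip {k : ℕ} (P : Params) (ξ : Fin (2 ^ k) → ℤˣ) (x : EuclideanSpace ℝ (Fin (2 ^ k))) :
    EuclideanSpace ℝ (Fin (2 ^ k)) :=
  WithLp.toLp 2 (flatten ξ *ᵥ (clip P x).ofLp)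

theorem norm_flatClip_le {k : ℕ} (P : Params) (ξ : Fin (2 ^ k) → ℤˣ)
    (x : EuclideanSpace ℝ (Fin (2 ^ k))) : ‖flatClip P ξ x‖ ≤ P.c / P.γ := by
  have h1 : ‖flatClip P ξ x‖ = ‖clip P x‖ := by
    have h : ‖flatClip P ξ x‖ ^ 2 = ‖clip P x‖ ^ 2 := by
      rw [EuclideanSpace.real_norm_sq_eq, EuclideanSpace.real_norm_sq_eq]
      have hdot : ∀ v : Fin (2 ^ k) → ℝ, ∑ i, v i ^ 2 = v ⬝ᵥ v := fun v => by
        simp [dotProduct, sq]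
      rw [hdot, hdot]
      simp only [flatClip]
      rw [Matrix.dotProduct_mulVec, Matrix.vecMul_mulVec, ← Matrix.dotProduct_mulVec,
        flatten_transpose_mul_self, Matrix.one_mulVec]
    exact (pow_left_inj₀ (norm_nonneg _) (norm_nonneg _) two_ne_zero).1 h
  rw [h1, clip, norm_smul]
  have hγ := P.γ_pos
  have hc := P.c_pos
  have hmin : 0 ≤ min 1 (P.c / ‖x‖) := by positivity
  rw [Real.norm_of_nonneg (by positivity), one_div, mul_assoc, div_eq_inv_mul P.c P.γ]
  refine mul_le_mul_of_nonneg_left ?_ (inv_nonneg.2 hγ.le)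
  rcases eq_or_ne x 0 with rfl | hx
  · simpa using hc.le
  · calc min 1 (P.c / ‖x‖) * ‖x‖ ≤ P.c / ‖x‖ * ‖x‖ := by gcongr; exact min_le_right _ _
      _ = P.c := div_mul_cancel₀ _ (norm_ne_zero_iff.2 hx)

/-- The client procedure with input `x` and shared randomness `ξ`: the law of its output in
`(ℤ/mℤ)^d`, where `d = 2 ^ k`. -/
def client {k : ℕ} (P : Params) (ξ : Fin (2 ^ k) → ℤˣ) (x : EuclideanSpace ℝ (Fin (2 ^ k))) :
    PMF (Fin (2 ^ k) → ZMod P.m) :=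
  (condRound (P.c / P.γ) P.β (flatClip P ξ x) (norm_flatClip_le P ξ x)).bind fun w =>
    (independent fun _ : Fin (2 ^ k) =>
      discreteGaussian (P.σ / P.γ) (div_pos P.σ_pos P.γ_pos)).map fun y =>
        fun j => ((w j + y j : ℤ) : ZMod P.m)

/-- The server procedure: each residue class is mapped to its representative in `(-m/2, m/2]`,
and the flattening and rescaling are undone. -/
def server {k : ℕ} (P : Params) (ξ : Fin (2 ^ k) → ℤˣ) (z : Fin (2 ^ k) → ZMod P.m) :
    EuclideanSpace ℝ (Fin (2 ^ k)) :=
  P.γ • WithLp.toLp 2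
    ((signMatrix ξ * (walshHadamard k)ᵀ) *ᵥ fun j => ((z j).valMinAbs : ℝ))

/-- The law of the output of the whole system on the inputs `x 0, …, x (n - 1)`: the shared signs
are uniform, the clients run independently, and the server receives only the sum, modulo `m`, of
their outputs. -/
def system {n k : ℕ} (P : Params) (x : Fin n → EuclideanSpace ℝ (Fin (2 ^ k))) :
    PMF (EuclideanSpace ℝ (Fin (2 ^ k))) :=
  (PMF.uniformOfFintype (Fin (2 ^ k) → ℤˣ)).bind fun ξ =>
    (independent fun i => client P ξ (x i)).map fun z => server P ξ (∑ i, z i)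

/-! ### Privacy and accuracy -/

/-- The Rényi divergence `D_α(P ‖ Q) = log (E_{y ← P} [(P(y) / Q(y)) ^ (α - 1)]) / (α - 1)` of
discrete distributions, for `α > 1`; it is `+∞` if `P` is not absolutely continuous with respect
to `Q`. -/
def renyiDiv {Y : Type*} (α : ℝ) (P Q : PMF Y) : EReal :=
  open Classical in
  if ∀ y, Q y = 0 → P y = 0 then
    (((α - 1)⁻¹ : ℝ) : EReal) * ENNReal.log (∑' y, P y * (P y / Q y) ^ (α - 1))
  else ⊤

/-- `D_*(P ‖ Q) = sup_{α > 1} D_α(P ‖ Q) / α`. -/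
def renyiDivStar {Y : Type*} (P Q : PMF Y) : EReal :=
  ⨆ (α : ℝ) (_ : 1 < α), ((α⁻¹ : ℝ) : EReal) * renyiDiv α P Q

/-- Two inputs with the same number of entries differ by the addition or removal of one entry:
one of them is the other one with that entry set to zero. -/
def Neighbors {X : Type*} [Zero X] {n : ℕ} (x x' : Fin n → X) : Prop :=
  ∃ i, x' = Function.update x i 0 ∨ x = Function.update x' i 0

/-- `ρ`-concentrated differential privacy. -/
def IsConcentratedDP {X Y : Type*} [Zero X] {n : ℕ} (ρ : ℝ) (M : (Fin n → X) → PMF Y) : Prop :=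
  ∀ x x', Neighbors x x' → renyiDivStar (M x) (M x') ≤ (ρ : EReal)

/-- The mean squared error `E_{y ← P} ‖y - v‖²`. -/
def meanSquaredError {d : ℕ} (P : PMF (EuclideanSpace ℝ (Fin d)))
    (v : EuclideanSpace ℝ (Fin d)) : ℝ≥0∞ :=
  ∑' y, P y * ENNReal.ofReal (‖y - v‖ ^ 2)

/-- `f` and `g` agree up to the factor `A (log (2 + m)) ^ p`: the relation behind `f = Θ̃(g)`. -/
def AgreeUpToLog (A : ℝ) (p m : ℕ) (f g : ℝ) : Prop :=
  f ≤ A * Real.log (2 + m) ^ p * g ∧ g ≤ A * Real.log (2 + m) ^ p * f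

/-- The quantity `n + √(ε² n³ / d) + √d / ε`, which the modulus has to exceed up to a
polylogarithmic factor. -/
def modulusScale (n d : ℕ) (ε : ℝ) : ℝ :=
  (n : ℝ) + √(ε ^ 2 * (n : ℝ) ^ 3 / d) + √(d : ℝ) / ε

end SecSum

end

noncomputable section

namespace SecSum

/-! ### Independent families of discrete random variables -/

/-! Privacy. Reduction mod `m` is additive, so the server's view is a function of the signs and of
the integer sum of rounded inputs and noise. Zero rounds to zero with certainty. Hence, once the
signs and all rounded inputs are fixed, removing client `i` only undoes a translation of the total
noise by the accepted vector `w i`, of norm at most `c/γ + √d`. Joint convexity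
(`renyiMoment_bind_le`) and data processing (`renyiMoment_map_le`) of Rényi moments, both from
Hölder, reduce the claim to translated noise. By Poisson summation a shifted theta sum of large
scale is nearly constant, so a sum of `n` discrete Gaussians is a Gaussian weight of variance `n s²`
up to a factor `e ^ τ` with `τ` tiny (`isNearGaussian_iterSum`). A nonzero integer shift has length
at least 1, so its Gaussian cost already dominates `τ`, and the error only changes a constant
(`renyiMoment_shift_le_of_error_le`).

Accuracy. The flattening matrix is orthogonal, so the error may be measured coordinatewise before
unflattening (`norm_server_sub_sq`). It splits into the deviation of the integer sum from its target
and the wrap-around mod `m`. Everything rests on exponential moments: rounding is subgaussian by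
Hoeffding, the discrete Gaussian because theta sums peak at integral shifts, and the target because
the signs are random and all Hadamard entries have size `1/√d`. Acceptance has probability at least
`1 - β`, so conditioning costs a factor `(1 - β)⁻¹` per client, bounded in total since `β ≤ K/n`; no
separate bias estimate is needed. Wrap-around forces `|S| ≥ m/2`, and its exponential moment is
damped by `(2 + m)⁻²`.

Parameters. `γ` is `4 log (2 + m)` times the scale in the statement, which makes wrap-around rare;
`σ` makes the privacy bound an equality. The lower bound on `m` keeps `γ` small enough for the noise
to be wide on the grid and for rounding to be cheap. -/

theorem tsum_pi_prod {α : Type*} :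
    ∀ {n : ℕ} (F : Fin n → α → ℝ≥0∞), ∑' f : Fin n → α, ∏ i, F i (f i) = ∏ i, ∑' a, F i a
  | 0, F => by simp
  | n + 1, F => by
    rw [← (Fin.consEquiv fun _ : Fin (n + 1) => α).tsum_eq, ENNReal.tsum_prod']
    have h : ∀ (a : α) (f : Fin n → α),
        ∏ i, F i ((Fin.consEquiv fun _ : Fin (n + 1) => α) (a, f) i)
          = F 0 a * ∏ i, F i.succ (f i) := by
      intro a f
      rw [Fin.prod_univ_succ]
      simp [Fin.consEquiv]
    simp_rw [h, ENNReal.tsum_mul_left, tsum_pi_prod fun i : Fin n => F i.succ,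
      ENNReal.tsum_mul_right]
    rw [Fin.prod_univ_succ]

theorem independent_apply {α : Type*} {n : ℕ} (p : Fin n → PMF α) (f : Fin n → α) :
    independent p f = ∏ i, p i (f i) := rfl

theorem independent_bind {α β : Type*} {n : ℕ} (p : Fin n → PMF α) (q : Fin n → α → PMF β) :
    independent (fun i => (p i).bind (q i))
      = (independent p).bind fun a => independent fun i => q i (a i) := by
  ext y
  simp only [independent_apply, PMF.bind_apply, ← Finset.prod_mul_distrib]
  rw [tsum_pi_prod fun i a => p i a * q i a (y i)]

theorem independent_pure {α : Type*} {n : ℕ} (a : Fin n → α) :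
    independent (fun i => PMF.pure (a i)) = PMF.pure a := by
  classical
  ext y
  simp only [independent_apply, PMF.pure_apply]
  by_cases h : y = a
  · subst h; simp
  · rw [if_neg h]
    obtain ⟨i, hi⟩ := Function.ne_iff.1 h
    exact Finset.prod_eq_zero (Finset.mem_univ i) (if_neg hi)

theorem independent_map {α β : Type*} {n : ℕ} (p : Fin n → PMF α) (h : Fin n → α → β) :
    independent (fun i => (p i).map (h i)) = (independent p).map fun a i => h i (a i) := by
  have : ∀ i, (p i).map (h i) = (p i).bind fun a => PMF.pure (h i a) := fun i => rfl
  simp_rw [this]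
  rw [independent_bind]
  simp_rw [independent_pure]
  rfl

/-- A family of independent rows of independent entries may be sampled by columns. -/
theorem independent_swap {α : Type*} {n d : ℕ} (p : Fin n → Fin d → PMF α) :
    independent (fun i => independent (p i))
      = (independent fun j => independent fun i => p i j).map fun f i j => f j i := by
  ext y
  have h := PMF.map_apply (fun (f : Fin d → Fin n → α) i j => f j i)
    (independent fun j => independent fun i => p i j) y
  rw [h, tsum_eq_single fun j i => y i j]
  · simp only [if_true, independent_apply]
    exact Finset.prod_comm
  · intro f hf
    rw [if_neg]
    rintro rfl
    exact hf rfl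

/-- The law of the sum of `n` independent variables with law `p`. -/
def iterSum {M : Type*} [AddCommMonoid M] (p : PMF M) (n : ℕ) : PMF M :=
  (independent fun _ : Fin n => p).map fun f => ∑ i, f i

theorem iterSum_succ {M : Type*} [AddCommMonoid M] (p : PMF M) (n : ℕ) :
    iterSum p (n + 1) = p.bind fun x => (iterSum p n).map (x + ·) := by
  classical
  have h : ∀ F : (Fin (n + 1) → M) → ℝ≥0∞,
      ∑' f, F f = ∑' (a : M) (f : Fin n → M), F (Fin.cons a f) := fun F => by
    rw [← (Fin.consEquiv fun _ : Fin (n + 1) => M).tsum_eq, ENNReal.tsum_prod']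
    rfl
  ext y
  simp only [iterSum, PMF.map_comp, PMF.bind_apply, PMF.map_apply, h, ← ENNReal.tsum_mul_left]
  refine tsum_congr fun a => tsum_congr fun f => ?_
  simp only [Fin.sum_univ_succ, Fin.cons_zero, Fin.cons_succ, independent_apply,
    Fin.prod_univ_succ, Function.comp_apply]
  split_ifs <;> simp

theorem iterSum_one {M : Type*} [AddCommMonoid M] (p : PMF M) : iterSum p 1 = p := by
  rw [iterSum_succ]
  have h : iterSum p 0 = PMF.pure 0 := by
    ext y
    simp [iterSum, PMF.map_apply, independent_apply, PMF.pure_apply]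
  simp [h, PMF.pure_map]

/-! ### Expectations of nonnegative functions -/

/-- The expectation of a nonnegative function. -/
def expect {α : Type*} (p : PMF α) (F : α → ℝ≥0∞) : ℝ≥0∞ := ∑' a, p a * F a

theorem expect_bind {α β : Type*} (p : PMF α) (q : α → PMF β) (F : β → ℝ≥0∞) :
    expect (p.bind q) F = expect p fun a => expect (q a) F := by
  simp only [expect, PMF.bind_apply, ← ENNReal.tsum_mul_right, ← ENNReal.tsum_mul_left]
  rw [ENNReal.tsum_comm]
  simp only [mul_assoc]

theorem expect_pure {α : Type*} (a : α) (F : α → ℝ≥0∞) : expect (PMF.pure a) F = F a := by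
  classical
  rw [expect, tsum_eq_single a]
  · simp
  · intro b hb
    simp [PMF.pure_apply, hb]

theorem expect_map {α β : Type*} (p : PMF α) (h : α → β) (F : β → ℝ≥0∞) :
    expect (p.map h) F = expect p fun a => F (h a) := by
  rw [← PMF.bind_pure_comp, expect_bind]
  simp [expect_pure]

theorem expect_independent_prod {α : Type*} {n : ℕ} (p : Fin n → PMF α)
    (F : Fin n → α → ℝ≥0∞) :
    expect (independent p) (fun a => ∏ i, F i (a i)) = ∏ i, expect (p i) (F i) := by
  simp only [expect, independent_apply, ← Finset.prod_mul_distrib]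
  exact tsum_pi_prod fun i a => p i a * F i a

theorem expect_independent_coord {α : Type*} {n : ℕ} (p : Fin n → PMF α) (j : Fin n)
    (F : α → ℝ≥0∞) :
    expect (independent p) (fun a => F (a j)) = expect (p j) F := by
  classical
  have h := expect_independent_prod p fun i a => if i = j then F a else 1
  simp only [Finset.prod_ite_eq', Finset.mem_univ, if_true] at h
  rw [h, Finset.prod_eq_single j]
  · simp
  · intro i _ hi
    simp [hi, expect, (p i).tsum_coe]
  · simp

theorem expect_mono {α : Type*} (p : PMF α) {F G : α → ℝ≥0∞}
    (h : ∀ a, p a ≠ 0 → F a ≤ G a) : expect p F ≤ expect p G := by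
  refine ENNReal.tsum_le_tsum fun a => ?_
  by_cases ha : p a = 0
  · simp [ha]
  · gcongr
    exact h a ha

theorem expect_const {α : Type*} (p : PMF α) (C : ℝ≥0∞) : expect p (fun _ => C) = C := by
  rw [expect, ENNReal.tsum_mul_right, p.tsum_coe, one_mul]

theorem expect_le_const {α : Type*} (p : PMF α) {F : α → ℝ≥0∞} {C : ℝ≥0∞}
    (h : ∀ a, p a ≠ 0 → F a ≤ C) : expect p F ≤ C :=
  (expect_mono p h).trans (expect_const p C).le

theorem expect_add {α : Type*} (p : PMF α) (F G : α → ℝ≥0∞) :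
    expect p (fun a => F a + G a) = expect p F + expect p G := by
  simp only [expect, mul_add, ENNReal.tsum_add]

theorem expect_sum {α ι : Type*} (p : PMF α) (s : Finset ι) (F : ι → α → ℝ≥0∞) :
    expect p (fun a => ∑ i ∈ s, F i a) = ∑ i ∈ s, expect p (F i) := by
  simp only [expect, Finset.mul_sum]
  exact Summable.tsum_finsetSum fun _ _ => ENNReal.summable

theorem expect_const_mul {α : Type*} (p : PMF α) (C : ℝ≥0∞) (F : α → ℝ≥0∞) :
    expect p (fun a => C * F a) = C * expect p F := by
  simp only [expect, mul_left_comm _ C, ENNReal.tsum_mul_left]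

theorem expect_mul_const {α : Type*} (p : PMF α) (C : ℝ≥0∞) (F : α → ℝ≥0∞) :
    expect p (fun a => F a * C) = expect p F * C := by
  simp only [expect, ← mul_assoc, ENNReal.tsum_mul_right]

/-! ### Rényi moments -/

/-- The summand `f (f / g) ^ r` of the Rényi moment of order `1 + r`. -/
def renyiTerm (r : ℝ) (f g : ℝ≥0∞) : ℝ≥0∞ := f * (f / g) ^ r

/-- The Rényi moment `E_{y ← P} [(P(y) / Q(y)) ^ r]`. -/
def renyiMoment {Y : Type*} (r : ℝ) (P Q : PMF Y) : ℝ≥0∞ := ∑' y, renyiTerm r (P y) (Q y)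

theorem renyiTerm_zero_left (r : ℝ) (g : ℝ≥0∞) : renyiTerm r 0 g = 0 := by simp [renyiTerm]

theorem renyiTerm_mul {r : ℝ} (hr : 0 < r) {a b c d : ℝ≥0∞} (hc : c ≠ ∞)
    (hd : d ≠ ∞) :
    renyiTerm r (a * b) (c * d) = renyiTerm r a c * renyiTerm r b d := by
  unfold renyiTerm
  have h : a * b / (c * d) = a / c * (b / d) := by
    rw [div_eq_mul_inv, div_eq_mul_inv, div_eq_mul_inv,
      ENNReal.mul_inv (Or.inr hd) (Or.inl hc)]
    ring
  rw [h, ENNReal.mul_rpow_of_nonneg _ _ hr.le]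
  ring

theorem renyiTerm_prod {ι : Type*} {r : ℝ} (hr : 0 < r) (s : Finset ι) (f g : ι → ℝ≥0∞)
    (hg : ∀ i, g i ≠ ∞) :
    renyiTerm r (∏ i ∈ s, f i) (∏ i ∈ s, g i) = ∏ i ∈ s, renyiTerm r (f i) (g i) := by
  classical
  induction s using Finset.induction_on with
  | empty => simp [renyiTerm]
  | insert i s hi ih =>
    rw [Finset.prod_insert hi, Finset.prod_insert hi, Finset.prod_insert hi,
      renyiTerm_mul hr (hg i)
        (ENNReal.prod_ne_top fun j _ => hg j), ih]

theorem renyiMoment_independent {α : Type*} {n : ℕ} {r : ℝ} (hr : 0 < r)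
    (p q : Fin n → PMF α) :
    renyiMoment r (independent p) (independent q) = ∏ i, renyiMoment r (p i) (q i) := by
  simp only [renyiMoment, independent_apply]
  rw [← tsum_pi_prod fun i a => renyiTerm r (p i a) (q i a)]
  refine tsum_congr fun f => renyiTerm_prod hr _ _ _ ?_
  exact fun i => (q i).apply_ne_top _

/-- Hölder's inequality for the counting measure. -/
theorem tsum_rpow_mul_rpow_le {ι : Type*} (f g : ι → ℝ≥0∞) {p q : ℝ} (hp : 0 ≤ p)
    (hq : 0 ≤ q) (hpq : p + q = 1) :
    ∑' i, f i ^ p * g i ^ q ≤ (∑' i, f i) ^ p * (∑' i, g i) ^ q := by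
  let _ : MeasurableSpace ι := ⊤
  have h := ENNReal.lintegral_mul_norm_pow_le (μ := MeasureTheory.Measure.count)
    (f := f) (g := g) (Measurable.of_discrete).aemeasurable
    (Measurable.of_discrete).aemeasurable hp hq hpq
  simpa [MeasureTheory.lintegral_count] using h

/-- Joint subadditivity of the Rényi summand: the source of joint convexity and of the data
processing inequality. -/
theorem renyiTerm_tsum_le {ι : Type*} {r : ℝ} (hr : 0 < r) (f g : ι → ℝ≥0∞)
    (hg : ∑' i, g i ≠ ∞) :
    renyiTerm r (∑' i, f i) (∑' i, g i) ≤ ∑' i, renyiTerm r (f i) (g i) := by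
  by_cases htop : ∑' i, renyiTerm r (f i) (g i) = ∞
  · rw [htop]; exact le_top
  have hr1 : 0 < 1 + r := by linarith
  -- The factorisation `f = (f ^ (1 + r) g ^ (-r)) ^ (1 / (1 + r)) · g ^ (r / (1 + r))` prepares
  -- Hölder. Finiteness of the summand excludes `g i = 0 < f i`.
  have hterm : ∀ i, f i = renyiTerm r (f i) (g i) ^ (1 / (1 + r)) * g i ^ (r / (1 + r)) := by
    intro i
    have hi : renyiTerm r (f i) (g i) ≠ ∞ := ENNReal.ne_top_of_tsum_ne_top htop i
    by_cases hf0 : f i = 0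
    · rw [hf0, renyiTerm_zero_left, ENNReal.zero_rpow_of_pos (by positivity), zero_mul]
    have hg0 : g i ≠ 0 := by
      intro h0
      apply hi
      rw [renyiTerm, h0, ENNReal.div_zero hf0, ENNReal.top_rpow_of_pos hr, ENNReal.mul_top hf0]
    have hgt : g i ≠ ∞ := ENNReal.ne_top_of_tsum_ne_top hg i
    have hfr : f i * (f i) ^ r = f i ^ (1 + r) := by
      rw [ENNReal.rpow_add_of_nonneg _ _ zero_le_one hr.le, ENNReal.rpow_one]
    have h1 : renyiTerm r (f i) (g i) = f i ^ (1 + r) * (g i ^ r)⁻¹ := by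
      rw [renyiTerm, div_eq_mul_inv, ENNReal.mul_rpow_of_nonneg _ _ hr.le, ← mul_assoc, hfr,
        ENNReal.inv_rpow]
    have hgr0 : g i ^ (r / (1 + r)) ≠ 0 := by
      rw [Ne, ENNReal.rpow_eq_zero_iff]; simp [hg0, hgt]
    have hgrt : g i ^ (r / (1 + r)) ≠ ∞ := by
      rw [Ne, ENNReal.rpow_eq_top_iff]; simp [hg0, hgt]
    rw [h1, ENNReal.mul_rpow_of_nonneg _ _ (by positivity), ← ENNReal.rpow_mul,
      ENNReal.inv_rpow, ← ENNReal.rpow_mul, mul_one_div_cancel hr1.ne', ENNReal.rpow_one,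
      mul_one_div, mul_assoc, ENNReal.inv_mul_cancel hgr0 hgrt, mul_one]
  have hsum : ∑' i, f i
      ≤ (∑' i, renyiTerm r (f i) (g i)) ^ (1 / (1 + r)) * (∑' i, g i) ^ (r / (1 + r)) := by
    calc ∑' i, f i = ∑' i, renyiTerm r (f i) (g i) ^ (1 / (1 + r)) * g i ^ (r / (1 + r)) :=
          tsum_congr hterm
      _ ≤ _ := tsum_rpow_mul_rpow_le _ _ (by positivity) (by positivity)
          (by field_simp)
  generalize ∑' i, renyiTerm r (f i) (g i) = Φ at *
  generalize ∑' i, f i = F at *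
  generalize ∑' i, g i = G at *
  have h2 : F ^ (1 + r) ≤ Φ * G ^ r := by
    calc F ^ (1 + r) ≤ (Φ ^ (1 / (1 + r)) * G ^ (r / (1 + r))) ^ (1 + r) := by gcongr
      _ = Φ * G ^ r := by
        rw [ENNReal.mul_rpow_of_nonneg _ _ hr1.le, ← ENNReal.rpow_mul, ← ENNReal.rpow_mul,
          one_div_mul_cancel hr1.ne', div_mul_cancel₀ _ hr1.ne', ENNReal.rpow_one]
  have hFr : F * F ^ r = F ^ (1 + r) := by
    rw [ENNReal.rpow_add_of_nonneg _ _ zero_le_one hr.le, ENNReal.rpow_one]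
  by_cases hG0 : G = 0
  · rw [hG0, ENNReal.zero_rpow_of_pos hr, mul_zero, nonpos_iff_eq_zero,
      ENNReal.rpow_eq_zero_iff_of_pos hr1] at h2
    rw [h2, renyiTerm_zero_left]
    exact zero_le
  calc renyiTerm r F G = F ^ (1 + r) / G ^ r := by
        rw [renyiTerm, div_eq_mul_inv, ENNReal.mul_rpow_of_nonneg _ _ hr.le, ← mul_assoc, hFr,
          ENNReal.inv_rpow, div_eq_mul_inv]
    _ ≤ Φ := ENNReal.div_le_of_le_mul h2

/-- Joint convexity: the common mixing weight `p a` cancels in the likelihood ratio. -/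
theorem renyiMoment_bind_le {α Y : Type*} {r : ℝ} (hr : 0 < r) (p : PMF α) (P Q : α → PMF Y) :
    renyiMoment r (p.bind P) (p.bind Q) ≤ expect p fun a => renyiMoment r (P a) (Q a) := by
  have h : ∀ y a, renyiTerm r (p a * P a y) (p a * Q a y)
      = p a * renyiTerm r (P a y) (Q a y) := by
    intro y a
    rw [renyiTerm_mul hr (p.apply_ne_top _) ((Q a).apply_ne_top _)]
    congr 1
    by_cases h0 : p a = 0
    · rw [h0, renyiTerm_zero_left]
    · rw [renyiTerm, ENNReal.div_self h0 (p.apply_ne_top _), ENNReal.one_rpow, mul_one]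
  calc renyiMoment r (p.bind P) (p.bind Q)
      ≤ ∑' y, ∑' a, renyiTerm r (p a * P a y) (p a * Q a y) := by
        refine ENNReal.tsum_le_tsum fun y => ?_
        simp only [PMF.bind_apply]
        exact renyiTerm_tsum_le hr _ _ ((p.bind Q).apply_ne_top y)
    _ = expect p fun a => renyiMoment r (P a) (Q a) := by
        simp only [h]
        rw [ENNReal.tsum_comm]
        simp only [ENNReal.tsum_mul_left, expect, renyiMoment]

/-- Data processing: subadditivity of the summand on each fibre of `h`. -/
theorem renyiMoment_map_le {X Y : Type*} {r : ℝ} (hr : 0 < r) (P Q : PMF X) (h : X → Y) :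
    renyiMoment r (P.map h) (Q.map h) ≤ renyiMoment r P Q := by
  classical
  calc renyiMoment r (P.map h) (Q.map h)
      ≤ ∑' y, ∑' x, renyiTerm r (if y = h x then P x else 0) (if y = h x then Q x else 0) := by
        refine ENNReal.tsum_le_tsum fun y => ?_
        have e : ∀ R : PMF X, R.map h y = ∑' x, if y = h x then R x else 0 := fun R => by
          rw [PMF.map_apply]
        rw [e, e]
        refine renyiTerm_tsum_le hr _ _ ?_
        rw [← e]
        exact (Q.map h).apply_ne_top y
    _ = renyiMoment r P Q := by
        rw [ENNReal.tsum_comm]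
        refine tsum_congr fun x => ?_
        rw [tsum_eq_single (h x)]
        · simp
        · intro y hy
          simp [hy, renyiTerm_zero_left]

/-- Rényi moments of order `r ≤ 1` are controlled by the one of order `1`. -/
theorem renyiMoment_le_rpow {Y : Type*} {r : ℝ} (hr : 0 < r) (hr1 : r ≤ 1) (P Q : PMF Y) :
    renyiMoment r P Q ≤ renyiMoment 1 P Q ^ r := by
  -- Hölder with exponents `r` and `1 - r`, since `P (P/Q) ^ r = (P²/Q) ^ r · P ^ (1 - r)`.
  have h := tsum_rpow_mul_rpow_le (fun y => renyiTerm 1 (P y) (Q y)) (fun y => P y) hr.le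
    (sub_nonneg.2 hr1) (by ring)
  rw [P.tsum_coe, ENNReal.one_rpow, mul_one] at h
  refine le_trans (ENNReal.tsum_le_tsum fun y => ?_) h
  by_cases h0 : P y = 0
  · rw [h0, renyiTerm_zero_left]; exact zero_le
  apply le_of_eq
  rw [renyiTerm, renyiTerm, ENNReal.rpow_one, ENNReal.mul_rpow_of_nonneg _ _ hr.le, mul_right_comm,
    ← ENNReal.rpow_add _ _ h0 (P.apply_ne_top y)]
  simp

theorem renyiMoment_map_equiv {X Y : Type*} (r : ℝ) (P Q : PMF X) (e : X ≃ Y) :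
    renyiMoment r (P.map e) (Q.map e) = renyiMoment r P Q := by
  classical
  have h : ∀ (R : PMF X) (x : X), R.map e (e x) = R x := by
    intro R x
    rw [PMF.map_apply, tsum_eq_single x]
    · simp
    · intro x' hx'
      simp [hx'.symm]
  rw [renyiMoment, ← e.tsum_eq]
  simp only [h, renyiMoment]

theorem renyiDiv_le_of_renyiMoment_le {Y : Type*} {α ρ : ℝ} (hα : 1 < α) {P Q : PMF Y}
    (h : renyiMoment (α - 1) P Q ≤ ENNReal.ofReal (Real.exp ((α - 1) * ρ))) :
    renyiDiv α P Q ≤ (ρ : EReal) := by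
  have hr : 0 < α - 1 := by linarith
  -- A finite moment forces absolute continuity: a point with `Q y = 0 ≠ P y` contributes `∞`.
  have hac : ∀ y, Q y = 0 → P y = 0 := by
    intro y hy
    by_contra h0
    have h1 : renyiMoment (α - 1) P Q = ∞ := by
      refine ENNReal.tsum_eq_top_of_eq_top ⟨y, ?_⟩
      rw [renyiTerm, hy, ENNReal.div_zero h0, ENNReal.top_rpow_of_pos hr, ENNReal.mul_top h0]
    rw [h1, top_le_iff] at h
    exact ENNReal.ofReal_ne_top h
  rw [renyiDiv, if_pos hac]
  have hlog : ENNReal.log (∑' y, P y * (P y / Q y) ^ (α - 1)) ≤ (((α - 1) * ρ : ℝ) : EReal) := by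
    refine (ENNReal.log_monotone h).trans ?_
    rw [ENNReal.log_ofReal_of_pos (Real.exp_pos _), Real.log_exp]
  calc (((α - 1)⁻¹ : ℝ) : EReal) * ENNReal.log (∑' y, P y * (P y / Q y) ^ (α - 1))
      ≤ (((α - 1)⁻¹ : ℝ) : EReal) * (((α - 1) * ρ : ℝ) : EReal) := by
        refine mul_le_mul_of_nonneg_left hlog ?_
        exact_mod_cast (inv_pos.2 hr).le
    _ = (ρ : EReal) := by
        rw [← EReal.coe_mul]
        congr 1
        field_simp

theorem renyiDivStar_le {Y : Type*} {ρ : ℝ} {P Q : PMF Y}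
    (h : ∀ r : ℝ, 0 < r →
      renyiMoment r P Q ≤ ENNReal.ofReal (Real.exp (r * (r + 1) * ρ))) :
    renyiDivStar P Q ≤ (ρ : EReal) := by
  refine iSup₂_le fun α hα => ?_
  have hα0 : 0 < α := by linarith
  have h1 : renyiDiv α P Q ≤ ((α * ρ : ℝ) : EReal) := by
    refine renyiDiv_le_of_renyiMoment_le hα ((h (α - 1) (by linarith)).trans_eq ?_)
    congr 2
    ring
  calc ((α⁻¹ : ℝ) : EReal) * renyiDiv α P Q ≤ ((α⁻¹ : ℝ) : EReal) * ((α * ρ : ℝ) : EReal) := by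
        refine mul_le_mul_of_nonneg_left h1 ?_
        exact_mod_cast (inv_pos.2 hα0).le
    _ = (ρ : EReal) := by
        rw [← EReal.coe_mul]
        congr 1
        field_simp

/-! ### Shifted theta sums -/

/-- The sum of the Gaussian weight with scale `s` centred at `μ` over the integers. -/
def theta (s μ : ℝ) : ℝ := ∑' x : ℤ, Real.exp (-((x : ℝ) - μ) ^ 2 / (2 * s ^ 2))

theorem summable_theta {s : ℝ} (hs : 0 < s) (μ : ℝ) :
    Summable fun x : ℤ => Real.exp (-((x : ℝ) - μ) ^ 2 / (2 * s ^ 2)) := by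
  have hT : 0 < 1 / (2 * Real.pi * s ^ 2) := by positivity
  have hsum := summable_pow_mul_jacobiTheta₂_term_bound (|μ| / (2 * Real.pi * s ^ 2)) hT 0
  refine hsum.of_nonneg_of_le (fun x => (Real.exp_pos _).le) fun x => ?_
  rw [pow_zero, one_mul]
  apply Real.exp_le_exp.2
  have hpi : Real.pi ≠ 0 := Real.pi_ne_zero
  have h1 : (x : ℝ) * μ ≤ |μ| * |(x : ℝ)| := by
    rw [mul_comm |μ|, ← abs_mul]; exact le_abs_self _
  have h2 : -Real.pi * (1 / (2 * Real.pi * s ^ 2) * (x : ℝ) ^ 2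
        - 2 * (|μ| / (2 * Real.pi * s ^ 2)) * ((|x| : ℤ) : ℝ))
      = (-(x : ℝ) ^ 2 + 2 * (|μ| * |(x : ℝ)|)) / (2 * s ^ 2) := by
    push_cast
    field_simp
    ring
  rw [h2]
  gcongr
  nlinarith [sq_nonneg μ]

theorem theta_pos {s : ℝ} (hs : 0 < s) (μ : ℝ) : 0 < theta s μ :=
  (summable_theta hs μ).tsum_pos (fun _ => (Real.exp_pos _).le) 0 (Real.exp_pos _)

/-- Poisson summation. On the dual side the shift `μ` only enters through phases, which is what
makes different shifts comparable. -/
theorem theta_eq_cexp {s : ℝ} (hs : 0 < s) (μ : ℝ) :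
    (theta s μ : ℂ) = ((2 * Real.pi * s ^ 2 : ℝ) : ℂ) ^ (1 / 2 : ℂ) *
      ∑' n : ℤ, Complex.exp (-Real.pi * ((2 * Real.pi * s ^ 2 : ℝ) : ℂ) * n ^ 2
        + 2 * Real.pi * (Complex.I * μ) * n) := by
  have ha : 0 < 2 * Real.pi * s ^ 2 := by positivity
  have hs' : (s : ℂ) ≠ 0 := by exact_mod_cast hs.ne'
  have hpi : (Real.pi : ℂ) ≠ 0 := by exact_mod_cast Real.pi_ne_zero
  rw [Complex.tsum_exp_neg_quadratic (by rwa [Complex.ofReal_re]) (Complex.I * μ), ← mul_assoc,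
    mul_one_div_cancel, one_mul, theta, Complex.ofReal_tsum]
  · refine tsum_congr fun n => ?_
    rw [Complex.ofReal_exp]
    congr 1
    rw [← mul_assoc, Complex.I_mul_I]
    push_cast
    field_simp
    ring
  · rw [Ne, Complex.cpow_eq_zero_iff]
    exact fun h => ha.ne' (by exact_mod_cast h.1)

theorem summable_exp_neg_mul_sq {a : ℝ} (ha : 0 < a) :
    Summable fun n : ℤ => Real.exp (-Real.pi * a * (n : ℝ) ^ 2) := by
  refine (summable_pow_mul_jacobiTheta₂_term_bound 0 ha 0).congr fun n => ?_
  rw [pow_zero, one_mul]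
  congr 1
  ring

theorem norm_cexp_neg_quadratic (a μ : ℝ) (n : ℤ) :
    ‖Complex.exp (-Real.pi * (a : ℂ) * n ^ 2 + 2 * Real.pi * (Complex.I * μ) * n)‖
      = Real.exp (-Real.pi * a * (n : ℝ) ^ 2) := by
  rw [Complex.norm_exp]
  congr 1
  have : (-Real.pi * (a : ℂ) * n ^ 2 + 2 * Real.pi * (Complex.I * μ) * n)
      = ((-Real.pi * a * (n : ℝ) ^ 2 : ℝ) : ℂ) + ((2 * Real.pi * μ * n : ℝ) : ℂ) * Complex.I := by
    push_cast
    ring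
  rw [this, Complex.add_re, Complex.ofReal_re, Complex.re_ofReal_mul, Complex.I_re, mul_zero,
    add_zero]

theorem theta_zero_eq {s : ℝ} (hs : 0 < s) :
    theta s 0 = (2 * Real.pi * s ^ 2) ^ (1 / 2 : ℝ) *
      ∑' n : ℤ, Real.exp (-Real.pi * (2 * Real.pi * s ^ 2) * (n : ℝ) ^ 2) := by
  have h := theta_eq_cexp hs 0
  have ha : 0 ≤ 2 * Real.pi * s ^ 2 := by positivity
  apply Complex.ofReal_injective
  rw [h]
  push_cast [Complex.ofReal_cpow ha]
  simp

theorem theta_eq_norm {s : ℝ} (hs : 0 < s) (μ : ℝ) :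
    theta s μ = (2 * Real.pi * s ^ 2) ^ (1 / 2 : ℝ) *
      ‖∑' n : ℤ, Complex.exp (-Real.pi * ((2 * Real.pi * s ^ 2 : ℝ) : ℂ) * n ^ 2
        + 2 * Real.pi * (Complex.I * μ) * n)‖ := by
  have ha : 0 < 2 * Real.pi * s ^ 2 := by positivity
  have h := congrArg norm (theta_eq_cexp hs μ)
  rw [Complex.norm_real, Real.norm_of_nonneg (theta_pos hs μ).le, norm_mul,
    Complex.norm_cpow_eq_rpow_re_of_pos ha] at h
  simpa using h

/-- The shifted theta sum is largest for integral shifts. -/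
theorem theta_le_theta_zero {s : ℝ} (hs : 0 < s) (μ : ℝ) : theta s μ ≤ theta s 0 := by
  have ha : 0 < 2 * Real.pi * s ^ 2 := by positivity
  rw [theta_eq_norm hs μ, theta_zero_eq hs]
  gcongr
  refine (norm_tsum_le_tsum_norm ?_).trans_eq ?_
  · simp_rw [norm_cexp_neg_quadratic]
    exact summable_exp_neg_mul_sq ha
  · simp_rw [norm_cexp_neg_quadratic]

theorem tsum_int_le_of_le_geometric {f : ℤ → ℝ} {q : ℝ} (hq0 : 0 ≤ q) (hq1 : q < 1)
    (hf : ∀ n, 0 ≤ f n) (h1 : ∀ k : ℕ, f k ≤ q ^ k)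
    (h2 : ∀ k : ℕ, f (-((k : ℤ) + 1)) ≤ q ^ k * q) : ∑' n, f n ≤ (1 + q) / (1 - q) := by
  have hgeom := hasSum_geometric_of_lt_one hq0 hq1
  have hs1 : Summable fun k : ℕ => f k :=
    Summable.of_nonneg_of_le (fun k => hf _) h1 hgeom.summable
  have hs2 : Summable fun k : ℕ => f (-((k : ℤ) + 1)) :=
    Summable.of_nonneg_of_le (fun k => hf _) h2 (hgeom.mul_right q).summable
  rw [(hs1.hasSum.of_nat_of_neg_add_one hs2.hasSum).tsum_eq]
  calc _ ≤ (1 - q)⁻¹ + (1 - q)⁻¹ * q :=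
        add_le_add (hasSum_le h1 hs1.hasSum hgeom) (hasSum_le h2 hs2.hasSum (hgeom.mul_right q))
    _ = (1 + q) / (1 - q) := by
        rw [div_eq_inv_mul]; ring

/-- Since `k ≤ k²`, each half of the sum is dominated by a geometric series. -/
theorem tsum_exp_neg_mul_sq_le {a : ℝ} (ha : 0 < a) :
    ∑' n : ℤ, Real.exp (-Real.pi * a * (n : ℝ) ^ 2)
      ≤ (1 + Real.exp (-Real.pi * a)) / (1 - Real.exp (-Real.pi * a)) := by
  have hpa : 0 < Real.pi * a := by positivity
  have hpow : ∀ k : ℕ, Real.exp (-Real.pi * a) ^ k = Real.exp (-Real.pi * a * k) := fun k => by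
    rw [← Real.exp_nat_mul]; congr 1; ring
  have hk : ∀ k : ℕ, (k : ℝ) ≤ (k : ℝ) ^ 2 := fun k => by
    exact_mod_cast Nat.le_self_pow two_ne_zero k
  refine tsum_int_le_of_le_geometric (Real.exp_pos _).le ?_ (fun n => (Real.exp_pos _).le)
    (fun k => ?_) (fun k => ?_)
  · rw [Real.exp_lt_one_iff]
    linarith
  · rw [hpow]
    apply Real.exp_le_exp.2
    rw [Int.cast_natCast]
    nlinarith [hk k]
  · rw [← pow_succ, hpow]
    apply Real.exp_le_exp.2
    have := hk (k + 1)
    push_cast at this ⊢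
    nlinarith

theorem exp_neg_le_quarter {x : ℝ} (hx : 3 ≤ x) : Real.exp (-x) ≤ 1 / 4 := by
  rw [Real.exp_neg, one_div]
  apply inv_anti₀ (by norm_num)
  linarith [Real.add_one_le_exp x]

/-- Shifted theta sums of large scale are nearly constant. -/
theorem theta_zero_le {s : ℝ} (hs : 0 < s) (hs2 : 1 / 2 ≤ s ^ 2) (μ : ℝ) :
    theta s 0 ≤ Real.exp (16 * Real.exp (-2 * Real.pi ^ 2 * s ^ 2)) * theta s μ := by
  have ha : 0 < 2 * Real.pi * s ^ 2 := by positivity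
  have hsum := summable_exp_neg_mul_sq ha
  have hT := tsum_exp_neg_mul_sq_le ha
  have hq' : -Real.pi * (2 * Real.pi * s ^ 2) = -2 * Real.pi ^ 2 * s ^ 2 := by ring
  rw [theta_eq_norm hs μ, theta_zero_eq hs]
  set T := ∑' n : ℤ, Real.exp (-Real.pi * (2 * Real.pi * s ^ 2) * (n : ℝ) ^ 2) with hTdef
  set f : ℤ → ℂ := fun n => Complex.exp (-Real.pi * ((2 * Real.pi * s ^ 2 : ℝ) : ℂ) * n ^ 2
        + 2 * Real.pi * (Complex.I * μ) * n) with hf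
  have hnorm : ∀ n, ‖f n‖ = Real.exp (-Real.pi * (2 * Real.pi * s ^ 2) * (n : ℝ) ^ 2) :=
    fun n => norm_cexp_neg_quadratic _ _ _
  have hfn : Summable fun n => ‖f n‖ := by simp_rw [hnorm]; exact hsum
  -- The term at `n = 0` is 1 and the others have total norm `T - 1`.
  have hlow : 2 - T ≤ ‖∑' n, f n‖ := by
    have e1 := hfn.of_norm.tsum_eq_add_tsum_ite 0
    have e2 := hfn.tsum_eq_add_tsum_ite 0
    have hf0 : f 0 = 1 := by simp [hf]
    have hTn : ∑' n, ‖f n‖ = T := by simp_rw [hnorm, hTdef]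
    rw [hTn, hf0, norm_one] at e2
    rw [hf0] at e1
    have e3 : ‖∑' n, ite (n = 0) 0 (f n)‖ ≤ ∑' n, ite (n = 0) 0 ‖f n‖ := by
      have e4 : ∀ n, ‖ite (n = 0) 0 (f n)‖ = ite (n = 0) 0 ‖f n‖ := fun n => by
        split_ifs <;> simp
      refine (norm_tsum_le_tsum_norm ?_).trans_eq (tsum_congr e4)
      refine hfn.of_nonneg_of_le (fun n => norm_nonneg _) fun n => ?_
      rw [e4]
      split_ifs
      · exact norm_nonneg _
      · exact le_rfl
    have e5 : (1 : ℝ) ≤ ‖∑' n, f n‖ + ‖∑' n, ite (n = 0) 0 (f n)‖ := by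
      calc (1 : ℝ) = ‖(1 : ℂ)‖ := by simp
        _ = ‖∑' n, f n - ∑' n, ite (n = 0) 0 (f n)‖ := by rw [e1]; simp
        _ ≤ _ := norm_sub_le _ _
    linarith
  rw [mul_left_comm]
  gcongr
  rw [hq'] at hT
  set q := Real.exp (-2 * Real.pi ^ 2 * s ^ 2) with hq
  have hq0 : 0 < q := Real.exp_pos _
  have hq4 : q ≤ 1 / 4 := by
    have := exp_neg_le_quarter (x := 2 * Real.pi ^ 2 * s ^ 2)
      (by nlinarith [Real.pi_gt_three])
    rwa [← neg_mul, ← neg_mul] at this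
  have hexp : 1 + 16 * q ≤ Real.exp (16 * q) := by linarith [Real.add_one_le_exp (16 * q)]
  have hT2 : T * (1 - q) ≤ 1 + q := (le_div_iff₀ (by linarith)).1 hT
  have h1 : T * (1 - 3 * q) ≤ (1 + q) * (2 - T) := by nlinarith
  have hT0 : 1 - 3 * q ≤ (2 - T) * (1 - q) := by nlinarith
  have h2T : 0 ≤ 2 - T := by
    by_contra hneg
    push Not at hneg
    nlinarith
  -- `T / (2 - T) ≤ (1 + q) / (1 - 3q)`, and this is at most `1 + 16q` exactly because `q ≤ 1/4`.
  calc T ≤ (1 + 16 * q) * (2 - T) := by nlinarith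
    _ ≤ Real.exp (16 * q) * (2 - T) := by gcongr
    _ ≤ Real.exp (16 * q) * ‖∑' n, f n‖ := by gcongr

/-! ### The discrete Gaussian -/

theorem tsum_ofReal_exp_eq_theta {s : ℝ} (hs : 0 < s) (μ : ℝ) :
    ∑' x : ℤ, ENNReal.ofReal (Real.exp (-((x : ℝ) - μ) ^ 2 / (2 * s ^ 2)))
      = ENNReal.ofReal (theta s μ) :=
  (ENNReal.ofReal_tsum_of_nonneg (fun _ => (Real.exp_pos _).le) (summable_theta hs μ)).symm

theorem discreteGaussian_apply {s : ℝ} (hs : 0 < s) (x : ℤ) :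
    discreteGaussian s hs x
      = ENNReal.ofReal ((theta s 0)⁻¹ * Real.exp (-(x : ℝ) ^ 2 / (2 * s ^ 2))) := by
  have h : ∑' x, gaussianWeight s x = ENNReal.ofReal (theta s 0) := by
    rw [← tsum_ofReal_exp_eq_theta hs 0]
    simp [gaussianWeight]
  rw [discreteGaussian, PMF.normalize_apply, h, ← ENNReal.ofReal_inv_of_pos (theta_pos hs 0),
    gaussianWeight, ← ENNReal.ofReal_mul (Real.exp_pos _).le, mul_comm]

/-- The discrete Gaussian is subgaussian. -/
theorem expect_exp_discreteGaussian_le {s : ℝ} (hs : 0 < s) (t : ℝ) :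
    expect (discreteGaussian s hs) (fun x => ENNReal.ofReal (Real.exp (t * x)))
      ≤ ENNReal.ofReal (Real.exp (t ^ 2 * s ^ 2 / 2)) := by
  have hθ := theta_pos hs 0
  -- Completing the square turns the tilt into a shift of the centre by `t s²`; a shifted theta sum
  -- is at most the centred one.
  have h : ∀ x : ℤ, discreteGaussian s hs x * ENNReal.ofReal (Real.exp (t * x))
      = ENNReal.ofReal ((theta s 0)⁻¹ * Real.exp (t ^ 2 * s ^ 2 / 2)) *
        ENNReal.ofReal (Real.exp (-((x : ℝ) - t * s ^ 2) ^ 2 / (2 * s ^ 2))) := by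
    intro x
    rw [discreteGaussian_apply hs, ← ENNReal.ofReal_mul (by positivity),
      ← ENNReal.ofReal_mul (by positivity), mul_assoc, mul_assoc, ← Real.exp_add, ← Real.exp_add]
    congr 3
    field_simp
    ring
  rw [expect, tsum_congr h, ENNReal.tsum_mul_left, tsum_ofReal_exp_eq_theta hs,
    ← ENNReal.ofReal_mul (by positivity)]
  apply ENNReal.ofReal_le_ofReal
  calc (theta s 0)⁻¹ * Real.exp (t ^ 2 * s ^ 2 / 2) * theta s (t * s ^ 2)
      ≤ (theta s 0)⁻¹ * Real.exp (t ^ 2 * s ^ 2 / 2) * theta s 0 := by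
        gcongr
        exact theta_le_theta_zero hs _
    _ = Real.exp (t ^ 2 * s ^ 2 / 2) := by field_simp

theorem map_add_left_apply (P : PMF ℤ) (a y : ℤ) : P.map (a + ·) y = P (y - a) := by
  classical
  rw [PMF.map_apply, tsum_eq_single (y - a)]
  · simp
  · intro b hb
    rw [if_neg]
    rintro rfl
    simp at hb

/-- `P` agrees with the Gaussian weight of variance `V` up to a constant and a factor in
`[1, e ^ τ]`. -/
def IsNearGaussian (P : PMF ℤ) (V τ : ℝ) : Prop :=
  ∃ κ : ℝ, 0 < κ ∧ ∀ y : ℤ, ENNReal.ofReal (κ * Real.exp (-(y : ℝ) ^ 2 / (2 * V))) ≤ P y ∧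
    P y ≤ ENNReal.ofReal (κ * Real.exp τ * Real.exp (-(y : ℝ) ^ 2 / (2 * V)))

theorem isNearGaussian_discreteGaussian {s : ℝ} (hs : 0 < s) {τ : ℝ} (hτ : 0 ≤ τ) :
    IsNearGaussian (discreteGaussian s hs) (s ^ 2) τ := by
  have hθ := theta_pos hs 0
  refine ⟨(theta s 0)⁻¹, by positivity, fun y => ⟨(discreteGaussian_apply hs y).ge, ?_⟩⟩
  rw [discreteGaussian_apply hs]
  apply ENNReal.ofReal_le_ofReal
  have : 1 ≤ Real.exp τ := Real.one_le_exp hτ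
  gcongr
  exact le_mul_of_one_le_right (by positivity) this

/-- The product of the two Gaussian weights in the convolution is a weight of variance `(k + 1) s²`
in `y` times one in `x` centred at `y / (k + 1)` with variance `v² = k s² / (k + 1) ≥ s² / 2`.
Summing over `x` gives a shifted theta sum of scale `v`, constant up to a factor `e ^ δ`. -/
theorem IsNearGaussian.bind_discreteGaussian {s k τ : ℝ} (hs : 0 < s) (hs1 : 1 ≤ s) (hk : 1 ≤ k)
    {P : PMF ℤ} (hP : IsNearGaussian P (k * s ^ 2) τ) :
    IsNearGaussian ((discreteGaussian s hs).bind fun x => P.map (x + ·)) ((k + 1) * s ^ 2)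
      (τ + 16 * Real.exp (-Real.pi ^ 2 * s ^ 2)) := by
  obtain ⟨κ, hκ, hP⟩ := hP
  have hk0 : 0 < k := by linarith
  have hθs := theta_pos hs 0
  set δ := 16 * Real.exp (-Real.pi ^ 2 * s ^ 2) with hδ
  have hv2pos : 0 < k * s ^ 2 / (k + 1) := by positivity
  set v := √(k * s ^ 2 / (k + 1)) with hv
  have hvpos : 0 < v := Real.sqrt_pos.2 hv2pos
  have hv2 : v ^ 2 = k * s ^ 2 / (k + 1) := Real.sq_sqrt hv2pos.le
  have hv2ge : s ^ 2 / 2 ≤ v ^ 2 := by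
    rw [hv2, div_le_div_iff₀ (by norm_num) (by positivity)]
    nlinarith [sq_nonneg s]
  have hθv : ∀ μ, theta v 0 ≤ Real.exp δ * theta v μ := by
    intro μ
    refine (theta_zero_le hvpos (by nlinarith) μ).trans ?_
    have hθ := (theta_pos hvpos μ).le
    have h1 : -2 * Real.pi ^ 2 * v ^ 2 ≤ -Real.pi ^ 2 * s ^ 2 := by
      nlinarith [sq_nonneg Real.pi]
    rw [hδ]
    gcongr
  have hexp : ∀ x y : ℤ, Real.exp (-(x : ℝ) ^ 2 / (2 * s ^ 2)) *
      Real.exp (-((y - x : ℤ) : ℝ) ^ 2 / (2 * (k * s ^ 2)))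
      = Real.exp (-(y : ℝ) ^ 2 / (2 * ((k + 1) * s ^ 2))) *
        Real.exp (-((x : ℝ) - y / (k + 1)) ^ 2 / (2 * v ^ 2)) := by
    intro x y
    rw [← Real.exp_add, ← Real.exp_add, hv2]
    congr 1
    push_cast
    field_simp
    ring
  have hsum : ∀ (c : ℝ) (_ : 0 ≤ c) (y : ℤ),
      ∑' x : ℤ, discreteGaussian s hs x *
        ENNReal.ofReal (c * Real.exp (-((y - x : ℤ) : ℝ) ^ 2 / (2 * (k * s ^ 2))))
      = ENNReal.ofReal ((theta s 0)⁻¹ * c * Real.exp (-(y : ℝ) ^ 2 / (2 * ((k + 1) * s ^ 2)))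
          * theta v (y / (k + 1))) := by
    intro c hc y
    rw [ENNReal.ofReal_mul (by positivity), ← tsum_ofReal_exp_eq_theta hvpos,
      ← ENNReal.tsum_mul_left]
    refine tsum_congr fun x => ?_
    rw [discreteGaussian_apply hs, ← ENNReal.ofReal_mul (by positivity),
      ← ENNReal.ofReal_mul (by positivity)]
    congr 1
    linear_combination (theta s 0)⁻¹ * c * hexp x y
  -- `e ^ (-δ) θ_v(0)` is a lower bound for all shifted theta sums of scale `v`, and `θ_v(0)` an
  -- upper bound.
  refine ⟨(theta s 0)⁻¹ * κ * (Real.exp (-δ) * theta v 0), ?_, fun y => ?_⟩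
  · have := theta_pos hvpos 0
    positivity
  simp only [PMF.bind_apply, map_add_left_apply]
  constructor
  · calc _ ≤ ENNReal.ofReal ((theta s 0)⁻¹ * κ *
            Real.exp (-(y : ℝ) ^ 2 / (2 * ((k + 1) * s ^ 2))) * theta v (y / (k + 1))) := by
          apply ENNReal.ofReal_le_ofReal
          have h1 : Real.exp (-δ) * theta v 0 ≤ theta v (y / (k + 1)) := by
            rw [Real.exp_neg, inv_mul_le_iff₀ (Real.exp_pos _)]
            exact hθv _
          rw [mul_right_comm]
          gcongr
      _ ≤ _ := by
          rw [← hsum κ hκ.le y]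
          exact ENNReal.tsum_le_tsum fun x => by gcongr; exact (hP _).1
  · calc _ ≤ ENNReal.ofReal ((theta s 0)⁻¹ * (κ * Real.exp τ) *
            Real.exp (-(y : ℝ) ^ 2 / (2 * ((k + 1) * s ^ 2))) * theta v (y / (k + 1))) := by
          rw [← hsum (κ * Real.exp τ) (by positivity) y]
          exact ENNReal.tsum_le_tsum fun x => by gcongr; exact (hP _).2
      _ ≤ _ := by
          apply ENNReal.ofReal_le_ofReal
          have h1 : Real.exp (-δ) * Real.exp (τ + δ) = Real.exp τ := by
            rw [← Real.exp_add]; congr 1; ring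
          calc _ ≤ (theta s 0)⁻¹ * (κ * Real.exp τ) *
                Real.exp (-(y : ℝ) ^ 2 / (2 * ((k + 1) * s ^ 2))) * theta v 0 := by
                gcongr
                exact theta_le_theta_zero hvpos _
            _ = _ := by rw [← h1]; ring

theorem isNearGaussian_iterSum {s : ℝ} (hs : 0 < s) (hs1 : 1 ≤ s) {n : ℕ} (hn : 1 ≤ n) :
    IsNearGaussian (iterSum (discreteGaussian s hs) n) (n * s ^ 2)
      (n * (16 * Real.exp (-Real.pi ^ 2 * s ^ 2))) := by
  induction n, hn using Nat.le_induction with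
  | base =>
    rw [iterSum_one, Nat.cast_one, one_mul]
    exact isNearGaussian_discreteGaussian hs (by positivity)
  | succ n hn ih =>
    have h := IsNearGaussian.bind_discreteGaussian hs hs1 (by exact_mod_cast hn) ih
    rw [iterSum_succ]
    convert h using 1 <;> push_cast <;> ring

/-! ### Rényi cost of shifting nearly Gaussian noise -/

theorem renyiTerm_mono {r : ℝ} (hr : 0 ≤ r) {f f' g g' : ℝ≥0∞} (hf : f ≤ f') (hg : g' ≤ g) :
    renyiTerm r f g ≤ renyiTerm r f' g' := by
  unfold renyiTerm
  gcongr

theorem renyiMoment_self {Y : Type*} (r : ℝ) (P : PMF Y) : renyiMoment r P P = 1 := by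
  rw [← P.tsum_coe]
  refine tsum_congr fun y => ?_
  by_cases h0 : P y = 0
  · rw [h0, renyiTerm_zero_left]
  · rw [renyiTerm, ENNReal.div_self h0 (P.apply_ne_top _), ENNReal.one_rpow, mul_one]

/-- Completing the square in `-(1 + r)(y - a)² + r y²` leaves a Gaussian weight centred at `(r + 1)
a` and the constant `r (r + 1) a²`. The numerator enters with power `1 + r`, whence the error `(r +
1) τ`. -/
theorem IsNearGaussian.renyiMoment_shift_le {P : PMF ℤ} {V τ r : ℝ} (hV : 0 < V) (hr : 0 < r)
    (hP : IsNearGaussian P V τ) (a : ℤ) :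
    renyiMoment r (P.map (a + ·)) P
      ≤ ENNReal.ofReal (Real.exp (r * (r + 1) * ((a : ℝ) ^ 2 / (2 * V)) + (r + 1) * τ)) := by
  obtain ⟨κ, hκ, hP⟩ := hP
  have hS : 0 < √V := Real.sqrt_pos.2 hV
  have hS2 : √V ^ 2 = V := Real.sq_sqrt hV.le
  -- The lower envelope has mass at most 1; this absorbs the theta sum below, which is largest at
  -- integral centres.
  have hmass : κ * theta √V 0 ≤ 1 := by
    have h : ∑' y : ℤ, ENNReal.ofReal (κ * Real.exp (-(y : ℝ) ^ 2 / (2 * V))) ≤ ∑' y, P y :=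
      ENNReal.tsum_le_tsum fun y => (hP y).1
    have e := tsum_ofReal_exp_eq_theta hS 0
    rw [hS2] at e
    simp only [sub_zero] at e
    simp only [ENNReal.ofReal_mul hκ.le] at h
    rw [P.tsum_coe, ENNReal.tsum_mul_left, e, ← ENNReal.ofReal_mul hκ.le] at h
    exact ENNReal.ofReal_le_one.1 h
  set E := Real.exp (r * (r + 1) * ((a : ℝ) ^ 2 / (2 * V)) + (r + 1) * τ) with hE
  have hterm : ∀ y : ℤ, renyiTerm r (P.map (a + ·) y) (P y) ≤
      ENNReal.ofReal (E * κ) *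
        ENNReal.ofReal (Real.exp (-((y : ℝ) - (r + 1) * a) ^ 2 / (2 * √V ^ 2))) := by
    intro y
    rw [map_add_left_apply]
    refine (renyiTerm_mono hr.le (hP (y - a)).2 (hP y).1).trans_eq ?_
    rw [renyiTerm, ← ENNReal.ofReal_div_of_pos (by positivity),
      ENNReal.ofReal_rpow_of_nonneg (by positivity) hr.le, ← ENNReal.ofReal_mul (by positivity),
      ← ENNReal.ofReal_mul (by positivity)]
    congr 1
    rw [hS2, mul_assoc κ, mul_assoc κ, mul_div_mul_left _ _ hκ.ne', ← Real.exp_add,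
      ← Real.exp_sub, ← Real.exp_mul, hE, mul_right_comm, ← Real.exp_add, mul_comm _ κ,
      ← Real.exp_add]
    congr 2
    push_cast
    field_simp
    ring
  calc renyiMoment r (P.map (a + ·)) P ≤ _ := ENNReal.tsum_le_tsum hterm
    _ = ENNReal.ofReal (E * κ * theta √V ((r + 1) * a)) := by
        rw [ENNReal.tsum_mul_left, tsum_ofReal_exp_eq_theta hS, ← ENNReal.ofReal_mul (by positivity)]
    _ ≤ ENNReal.ofReal E := by
        apply ENNReal.ofReal_le_ofReal
        calc E * κ * theta √V ((r + 1) * a) ≤ E * κ * theta √V 0 := by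
              gcongr
              exact theta_le_theta_zero hS _
          _ = E * (κ * theta √V 0) := mul_assoc _ _ _
          _ ≤ E * 1 := by gcongr
          _ = E := mul_one E

/-- If the noise is close enough to a Gaussian, then integer shifts cost at most a constant factor
more than in the Gaussian case, for all orders. -/
theorem IsNearGaussian.renyiMoment_shift_le_of_error_le {P : PMF ℤ} {V τ r : ℝ} (hV : 0 < V) (hr : 0 < r)
    (hP : IsNearGaussian P V τ) (hτ : τ ≤ 1 / (2 * V)) (a : ℤ) :
    renyiMoment r (P.map (a + ·)) P
      ≤ ENNReal.ofReal (Real.exp (r * (r + 1) * (2 * (a : ℝ) ^ 2 / V))) := by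
  rcases eq_or_ne a 0 with rfl | ha
  · have h : P.map ((0 : ℤ) + ·) = P := by
      simp only [zero_add]
      exact PMF.map_id P
    rw [h, renyiMoment_self]
    simp
  have ha1 : (1 : ℝ) ≤ (a : ℝ) ^ 2 := by
    have := Int.one_le_abs ha
    have h2 : (1 : ℝ) ≤ |(a : ℝ)| := by exact_mod_cast this
    rw [← sq_abs]
    nlinarith
  have hτ' : τ ≤ (a : ℝ) ^ 2 / (2 * V) := hτ.trans (by gcongr)
  have hq : 0 < (a : ℝ) ^ 2 / (2 * V) := by positivity
  have he : 2 * (a : ℝ) ^ 2 / V = 4 * ((a : ℝ) ^ 2 / (2 * V)) := by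
    field_simp
    ring
  rw [he]
  set A := (a : ℝ) ^ 2 / (2 * V) with hA
  -- The error `(r + 1) τ` does not vanish as `r → 0`, but the target does. For `r ≥ 1` it is at
  -- most `r (r + 1) A`; for `r ≤ 1` the moment is compared with the power `r` of the moment of
  -- order 1, whose exponent is at most `4 A`.
  rcases le_total 1 r with h1 | h1
  · refine (hP.renyiMoment_shift_le hV hr a).trans ?_
    rw [← hA]
    apply ENNReal.ofReal_le_ofReal
    apply Real.exp_le_exp.2
    have h2 : (r + 1) * τ ≤ (r + 1) * A := by gcongr
    have h3 : (r + 1) * A ≤ r * ((r + 1) * A) := le_mul_of_one_le_left (by positivity) h1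
    have h4 : 0 < r * ((r + 1) * A) := by positivity
    linarith
  · refine (renyiMoment_le_rpow hr h1 _ _).trans ?_
    calc _ ≤ ENNReal.ofReal (Real.exp (4 * A)) ^ r := by
          gcongr
          refine (hP.renyiMoment_shift_le hV one_pos a).trans ?_
          rw [← hA]
          apply ENNReal.ofReal_le_ofReal
          apply Real.exp_le_exp.2
          linarith
      _ = ENNReal.ofReal (Real.exp (4 * A * r)) := by
          rw [ENNReal.ofReal_rpow_of_pos (Real.exp_pos _), ← Real.exp_mul]
      _ ≤ _ := by
          apply ENNReal.ofReal_le_ofReal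
          apply Real.exp_le_exp.2
          have : 0 ≤ r * r * (4 * A) := by positivity
          linarith

/-- With `e = exp (s²)`: `n ≤ e`, `s² ≤ e`, `32 ≤ e ^ 5`, while `π² ≥ 9` gives the decay `e ^ (-9)`,
so one power of `e` is left over. -/
theorem gaussian_error_le {s : ℝ} {n : ℕ} (hn : 1 ≤ n) (hs1 : 1 ≤ s)
    (hs : Real.log (2 + n) ≤ s) :
    (n : ℝ) * (16 * Real.exp (-Real.pi ^ 2 * s ^ 2)) ≤ 1 / (2 * (n * s ^ 2)) := by
  have hn0 : (0 : ℝ) < n := by exact_mod_cast hn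
  have hs0 : 0 < s := by linarith
  have hss : s ≤ s ^ 2 := by nlinarith
  have h1 : (n : ℝ) ≤ Real.exp (s ^ 2) := by
    have : (n : ℝ) + 2 ≤ Real.exp s := by
      rw [add_comm]
      exact (Real.log_le_iff_le_exp (by positivity)).1 hs
    have := Real.exp_le_exp.2 hss
    linarith
  have h2 : s ^ 2 ≤ Real.exp (s ^ 2) := by linarith [Real.add_one_le_exp (s ^ 2)]
  have h3 : (32 : ℝ) ≤ Real.exp (s ^ 2) ^ 5 := by
    have : (2 : ℝ) ≤ Real.exp (s ^ 2) := by nlinarith [Real.add_one_le_exp (s ^ 2)]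
    calc (32 : ℝ) = 2 ^ 5 := by norm_num
      _ ≤ _ := by gcongr
  have h4 : Real.exp (-Real.pi ^ 2 * s ^ 2) ≤ (Real.exp (s ^ 2) ^ 9)⁻¹ := by
    rw [← Real.exp_nat_mul, ← Real.exp_neg]
    apply Real.exp_le_exp.2
    have : (9 : ℝ) ≤ Real.pi ^ 2 := by nlinarith [Real.pi_gt_three]
    push_cast
    nlinarith [sq_nonneg s]
  rw [le_div_iff₀ (by positivity)]
  set e := Real.exp (s ^ 2) with he
  have he0 : 0 < e := Real.exp_pos _
  have he1 : 1 ≤ e := Real.one_le_exp (by positivity)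
  calc (n : ℝ) * (16 * Real.exp (-Real.pi ^ 2 * s ^ 2)) * (2 * (n * s ^ 2))
      = 32 * n * n * s ^ 2 * Real.exp (-Real.pi ^ 2 * s ^ 2) := by ring
    _ ≤ e ^ 5 * e * e * e * (e ^ 9)⁻¹ := by gcongr
    _ = e⁻¹ := by field_simp
    _ ≤ 1 := inv_le_one_of_one_le₀ he1

theorem renyiMoment_iterSum_shift_le {s r : ℝ} (hs : 0 < s) (hs1 : 1 ≤ s) (hr : 0 < r) {n : ℕ}
    (hn : 1 ≤ n) (hsn : Real.log (2 + n) ≤ s) (a : ℤ) :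
    renyiMoment r ((iterSum (discreteGaussian s hs) n).map (a + ·))
        (iterSum (discreteGaussian s hs) n)
      ≤ ENNReal.ofReal (Real.exp (r * (r + 1) * (2 * (a : ℝ) ^ 2 / (n * s ^ 2)))) :=
  have hn0 : (0 : ℝ) < n := by exact_mod_cast hn
  (isNearGaussian_iterSum hs hs1 hn).renyiMoment_shift_le_of_error_le (by positivity) hr
    (gaussian_error_le hn hs1 hsn) a

theorem renyiMoment_noise_shift_le {s r : ℝ} (hs : 0 < s) (hs1 : 1 ≤ s) (hr : 0 < r) {n d : ℕ}
    (hn : 1 ≤ n) (hsn : Real.log (2 + n) ≤ s) (w : Fin d → ℤ) :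
    renyiMoment r
        ((independent fun _ : Fin d => iterSum (discreteGaussian s hs) n).map (w + ·))
        (independent fun _ : Fin d => iterSum (discreteGaussian s hs) n)
      ≤ ENNReal.ofReal (Real.exp (r * (r + 1) * (2 * ‖intVec w‖ ^ 2 / (n * s ^ 2)))) := by
  have h := independent_map (fun _ : Fin d => iterSum (discreteGaussian s hs) n)
    fun j => (w j + ·)
  have e : (fun (u : Fin d → ℤ) (j : Fin d) => w j + u j) = (w + ·) := rfl
  rw [e] at h
  rw [← h, renyiMoment_independent hr]
  calc _ ≤ ∏ j, ENNReal.ofReal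
        (Real.exp (r * (r + 1) * (2 * (w j : ℝ) ^ 2 / (n * s ^ 2)))) :=
        Finset.prod_le_prod' fun j _ => renyiMoment_iterSum_shift_le hs hs1 hr hn hsn (w j)
    _ = _ := by
        rw [← ENNReal.ofReal_prod_of_nonneg fun _ _ => (Real.exp_pos _).le, ← Real.exp_sum,
          ← Finset.mul_sum, ← Finset.sum_div, ← Finset.mul_sum, EuclideanSpace.real_norm_sq_eq]
        simp [intVec]

/-! ### Privacy -/

/-- The sum of the noise of all `n` clients. -/
def noise (P : Params) (n d : ℕ) : PMF (Fin d → ℤ) :=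
  independent fun _ => iterSum (discreteGaussian (P.σ / P.γ) (div_pos P.σ_pos P.γ_pos)) n

theorem noise_eq (P : Params) (n d : ℕ) :
    noise P n d = (independent fun _ : Fin n => independent fun _ : Fin d =>
      discreteGaussian (P.σ / P.γ) (div_pos P.σ_pos P.γ_pos)).map fun y j => ∑ i, y i j := by
  rw [independent_swap, PMF.map_comp, noise]
  simp only [iterSum]
  rw [independent_map]
  rfl

/-- The rounded inputs of all clients, given the shared signs. -/
def roundedInputs {n k : ℕ} (P : Params) (ξ : Fin (2 ^ k) → ℤˣ)
    (x : Fin n → EuclideanSpace ℝ (Fin (2 ^ k))) : PMF (Fin n → Fin (2 ^ k) → ℤ) :=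
  independent fun i =>
    condRound (P.c / P.γ) P.β (flatClip P ξ (x i)) (norm_flatClip_le P ξ (x i))

/-- What the server outputs when the sum over the integers is `S`. -/
def serverInt {k : ℕ} (P : Params) (ξ : Fin (2 ^ k) → ℤˣ) (S : Fin (2 ^ k) → ℤ) :
    EuclideanSpace ℝ (Fin (2 ^ k)) :=
  server P ξ fun j => (S j : ZMod P.m)

/-- Reduction mod `m` commutes with sums, so it can be postponed to the server; only the total noise
matters. -/
theorem system_eq {n k : ℕ} (P : Params) (x : Fin n → EuclideanSpace ℝ (Fin (2 ^ k))) :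
    system P x = (PMF.uniformOfFintype (Fin (2 ^ k) → ℤˣ)).bind fun ξ =>
      (roundedInputs P ξ x).bind fun w =>
        (noise P n (2 ^ k)).map fun u => serverInt P ξ (∑ i, w i + u) := by
  unfold system
  congr 1
  funext ξ
  simp only [client]
  rw [independent_bind, PMF.map_bind]
  unfold roundedInputs
  congr 1
  funext w
  rw [independent_map (fun _ : Fin n => independent fun _ : Fin (2 ^ k) =>
    discreteGaussian (P.σ / P.γ) (div_pos P.σ_pos P.γ_pos))
    (fun i y j => ((w i j + y j : ℤ) : ZMod P.m)), noise_eq, PMF.map_comp, PMF.map_comp]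
  congr 1
  funext y
  simp only [Function.comp_apply, serverInt]
  congr 1
  funext j
  simp [Finset.sum_add_distrib]

/-! ### Removing one client's input -/

theorem eq_pure_of_forall_ne {α : Type*} {p : PMF α} {a : α} (h : ∀ b, b ≠ a → p b = 0) :
    p = PMF.pure a := by
  classical
  have ha : p a = 1 := by
    rw [← p.tsum_coe, tsum_eq_single a h]
  ext b
  rw [PMF.pure_apply]
  split_ifs with hb
  · rw [hb, ha]
  · exact h b hb

theorem condRound_apply_ne_zero {d : ℕ} {r β : ℝ} {u : EuclideanSpace ℝ (Fin d)} {hu : ‖u‖ ≤ r}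
    {w : Fin d → ℤ} (h : condRound r β u hu w ≠ 0) : w ∈ accepted d r β ∧ roundVec u w ≠ 0 := by
  rw [condRound, PMF.filter_apply_ne_zero_iff] at h
  exact ⟨h.1, (PMF.mem_support_iff _ _).1 h.2⟩

theorem condRound_zero {d : ℕ} (r β : ℝ) (hu : ‖(0 : EuclideanSpace ℝ (Fin d))‖ ≤ r) :
    condRound r β 0 hu = PMF.pure 0 := by
  apply eq_pure_of_forall_ne
  intro w hw
  by_contra h
  have h1 := (condRound_apply_ne_zero h).2
  obtain ⟨j, hj⟩ := Function.ne_iff.1 hw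
  apply h1
  rw [roundVec, independent_apply]
  refine Finset.prod_eq_zero (Finset.mem_univ j) ?_
  have hj' : w j ≠ 0 := hj
  simp [roundCoord, hj']

theorem flatClip_zero {k : ℕ} (P : Params) (ξ : Fin (2 ^ k) → ℤˣ) : flatClip P ξ 0 = 0 := by
  simp [flatClip, clip]

theorem independent_update_pure {α : Type*} {n : ℕ} (p : Fin n → PMF α) (i : Fin n) (a : α) :
    independent (Function.update p i (PMF.pure a))
      = (independent p).map fun f => Function.update f i a := by
  have h := independent_map p fun l => if l = i then Function.const α a else id
  have e1 : (fun l => (p l).map (if l = i then Function.const α a else id))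
      = Function.update p i (PMF.pure a) := by
    funext l
    by_cases hl : l = i
    · subst hl
      simp [PMF.map_const]
    · simp [hl, PMF.map_id]
  have e2 : (fun (f : Fin n → α) l => (if l = i then Function.const α a else id) (f l))
      = fun f => Function.update f i a := by
    funext f l
    by_cases hl : l = i
    · subst hl
      simp
    · simp [hl]
  rw [← e1, h, e2]

theorem roundedInputs_update_zero {n k : ℕ} (P : Params) (ξ : Fin (2 ^ k) → ℤˣ)
    (x : Fin n → EuclideanSpace ℝ (Fin (2 ^ k))) (i : Fin n) :
    roundedInputs P ξ (Function.update x i 0)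
      = (roundedInputs P ξ x).map fun w => Function.update w i 0 := by
  rw [roundedInputs, roundedInputs, ← independent_update_pure]
  congr 1
  funext l
  by_cases hl : l = i
  · subst hl
    simp only [Function.update_self, flatClip_zero]
    exact condRound_zero _ _ _
  · simp only [Function.update_of_ne hl]

theorem sum_eq_add_sum_update {M : Type*} [AddCommMonoid M] {n : ℕ} (w : Fin n → M) (i : Fin n) :
    ∑ l, w l = w i + ∑ l, Function.update w i 0 l := by
  rw [Finset.sum_update_of_mem (Finset.mem_univ i), zero_add,
    Finset.sdiff_singleton_eq_erase, Finset.add_sum_erase _ _ (Finset.mem_univ i)]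

/-- Translating both laws by `-w` changes nothing; this gives the reverse direction of the
divergence. -/
theorem renyiMoment_translate {G : Type*} [AddCommGroup G] (r : ℝ) (P : PMF G) (w : G) :
    renyiMoment r P (P.map (w + ·)) = renyiMoment r (P.map (-w + ·)) P := by
  rw [← renyiMoment_map_equiv r P (P.map (w + ·)) (Equiv.addLeft (-w)), PMF.map_comp]
  have : ((Equiv.addLeft (-w) : G → G) ∘ (w + ·)) = id := by
    funext z
    simp
  rw [this, PMF.map_id]
  rfl

theorem norm_intVec_neg {d : ℕ} (w : Fin d → ℤ) : ‖intVec (-w)‖ = ‖intVec w‖ := by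
  simp [intVec, EuclideanSpace.norm_eq]

theorem isConcentratedDP_system {n k : ℕ} (P : Params) {ρ : ℝ} (hn : 1 ≤ n)
    (hs1 : 1 ≤ P.σ / P.γ) (hsn : Real.log (2 + n) ≤ P.σ / P.γ)
    (hρ : 2 * (P.c / P.γ + √((2 ^ k : ℕ) : ℝ)) ^ 2 / (n * (P.σ / P.γ) ^ 2) ≤ ρ) :
    IsConcentratedDP (n := n) (X := EuclideanSpace ℝ (Fin (2 ^ k))) ρ (system P) := by
  have hs := div_pos P.σ_pos P.γ_pos
  have hn0 : (0 : ℝ) < n := by exact_mod_cast hn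
  -- the cost of translating the noise by an accepted vector
  have hshift : ∀ (r : ℝ) (_ : 0 < r) (w : Fin (2 ^ k) → ℤ), w ∈ accepted (2 ^ k) (P.c / P.γ) P.β →
      renyiMoment r ((noise P n (2 ^ k)).map (w + ·)) (noise P n (2 ^ k))
          ≤ ENNReal.ofReal (Real.exp (r * (r + 1) * ρ)) ∧
        renyiMoment r (noise P n (2 ^ k)) ((noise P n (2 ^ k)).map (w + ·))
          ≤ ENNReal.ofReal (Real.exp (r * (r + 1) * ρ)) := by
    intro r hr w hw
    have hb : ENNReal.ofReal
          (Real.exp (r * (r + 1) * (2 * ‖intVec w‖ ^ 2 / (n * (P.σ / P.γ) ^ 2))))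
        ≤ ENNReal.ofReal (Real.exp (r * (r + 1) * ρ)) := by
      apply ENNReal.ofReal_le_ofReal
      apply Real.exp_le_exp.2
      have h1 : ‖intVec w‖ ≤ P.c / P.γ + √((2 ^ k : ℕ) : ℝ) := hw.1
      refine mul_le_mul_of_nonneg_left (le_trans ?_ hρ) (by positivity)
      gcongr
    refine ⟨(renyiMoment_noise_shift_le hs hs1 hr hn hsn w).trans hb, ?_⟩
    rw [renyiMoment_translate]
    refine (renyiMoment_noise_shift_le hs hs1 hr hn hsn (-w)).trans ?_
    rwa [norm_intVec_neg]
  have key : ∀ (x : Fin n → EuclideanSpace ℝ (Fin (2 ^ k))) (i : Fin n) (r : ℝ), 0 < r →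
      renyiMoment r (system P x) (system P (Function.update x i 0))
          ≤ ENNReal.ofReal (Real.exp (r * (r + 1) * ρ)) ∧
        renyiMoment r (system P (Function.update x i 0)) (system P x)
          ≤ ENNReal.ofReal (Real.exp (r * (r + 1) * ρ)) := by
    intro x i r hr
    -- The contribution `w i` is moved into the noise, so both systems apply the same map to the
    -- noise, translated or not.
    have hF : ∀ (ξ : Fin (2 ^ k) → ℤˣ) (w : Fin n → Fin (2 ^ k) → ℤ),
        (noise P n (2 ^ k)).map (fun u => serverInt P ξ (∑ l, w l + u))
          = ((noise P n (2 ^ k)).map (w i + ·)).map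
            fun u => serverInt P ξ (∑ l, Function.update w i 0 l + u) := by
      intro ξ w
      rw [PMF.map_comp]
      congr 1
      funext u
      simp only [Function.comp_apply]
      rw [sum_eq_add_sum_update w i]
      congr 1
      abel
    have hacc : ∀ (ξ : Fin (2 ^ k) → ℤˣ) (w : Fin n → Fin (2 ^ k) → ℤ),
        roundedInputs P ξ x w ≠ 0 → w i ∈ accepted (2 ^ k) (P.c / P.γ) P.β := by
      intro ξ w hw
      rw [roundedInputs, independent_apply, Finset.prod_ne_zero_iff] at hw
      exact (condRound_apply_ne_zero (hw i (Finset.mem_univ i))).1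
    rw [system_eq, system_eq]
    simp only [roundedInputs_update_zero, PMF.bind_map]
    constructor
    · refine (renyiMoment_bind_le hr _ _ _).trans (expect_le_const _ fun ξ _ => ?_)
      refine (renyiMoment_bind_le hr _ _ _).trans (expect_le_const _ fun w hw => ?_)
      rw [hF, Function.comp_apply]
      exact (renyiMoment_map_le hr _ _ _).trans (hshift r hr _ (hacc ξ w hw)).1
    · refine (renyiMoment_bind_le hr _ _ _).trans (expect_le_const _ fun ξ _ => ?_)
      refine (renyiMoment_bind_le hr _ _ _).trans (expect_le_const _ fun w hw => ?_)
      rw [hF, Function.comp_apply]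
      exact (renyiMoment_map_le hr _ _ _).trans (hshift r hr _ (hacc ξ w hw)).2
  rintro x x' ⟨i, rfl | rfl⟩
  · exact renyiDivStar_le fun r hr => (key x i r hr).1
  · exact renyiDivStar_le fun r hr => (key x' i r hr).2

/-! ### Moment generating functions of randomized rounding -/

/-- Hoeffding's lemma for a two-point distribution. -/
theorem hoeffding_two_point {p : ℝ} (hp0 : 0 ≤ p) (hp1 : p ≤ 1) (t : ℝ) :
    (1 - p) * Real.exp (t * (-p)) + p * Real.exp (t * (1 - p)) ≤ Real.exp (t ^ 2 / 8) := by
  have hq : 0 ≤ 1 - p := by linarith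
  set μ : MeasureTheory.Measure Bool := ENNReal.ofReal (1 - p) • MeasureTheory.Measure.dirac false
    + ENNReal.ofReal p • MeasureTheory.Measure.dirac true with hμ
  have hprob : MeasureTheory.IsProbabilityMeasure μ := ⟨by
    simp [hμ, ← ENNReal.ofReal_add hq hp0]⟩
  set X : Bool → ℝ := fun b => cond b 1 0 with hX
  have h := ProbabilityTheory.hasSubgaussianMGF_of_mem_Icc (μ := μ) (X := X) (a := 0) (b := 1)
    (Measurable.of_discrete).aemeasurable
    (Filter.Eventually.of_forall fun b => by cases b <;> simp [hX])
  have h2 := h.mgf_le t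
  have hint : ∀ f : Bool → ℝ, ∫ b, f b ∂μ = (1 - p) * f false + p * f true := by
    intro f
    rw [hμ, MeasureTheory.integral_add_measure
      (MeasureTheory.Integrable.of_finite.smul_measure ENNReal.ofReal_ne_top)
      (MeasureTheory.Integrable.of_finite.smul_measure ENNReal.ofReal_ne_top),
      MeasureTheory.integral_smul_measure, MeasureTheory.integral_smul_measure,
      MeasureTheory.integral_dirac, MeasureTheory.integral_dirac, ENNReal.toReal_ofReal hq,
      ENNReal.toReal_ofReal hp0, smul_eq_mul, smul_eq_mul]
  rw [ProbabilityTheory.mgf, hint, hint] at h2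
  simp only [hX, cond_false, cond_true, mul_zero, mul_one, zero_add, zero_sub] at h2
  convert h2 using 2
  simp
  ring

theorem expect_roundCoord (v : ℝ) (F : ℤ → ℝ≥0∞) :
    expect (roundCoord v) F
      = ENNReal.ofReal (1 - Int.fract v) * F ⌊v⌋ + ENNReal.ofReal (Int.fract v) * F (⌊v⌋ + 1) := by
  rw [expect, tsum_eq_sum (s := {⌊v⌋, ⌊v⌋ + 1}), Finset.sum_pair (by simp)]
  · simp [roundCoord]
  · intro b hb
    rw [roundCoord, PMF.ofFinset_apply_of_notMem _ _ hb, zero_mul]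

theorem abs_sub_le_one_of_roundCoord_ne_zero {v : ℝ} {w : ℤ} (h : roundCoord v w ≠ 0) :
    |(w : ℝ) - v| ≤ 1 := by
  have hw := (PMF.mem_support_ofFinset_iff _ _ _).1 ((PMF.mem_support_iff _ _).2 h)
  have h0 := Int.floor_le v
  have h1 := Int.lt_floor_add_one v
  rcases Finset.mem_insert.1 hw.1 with e | e
  · rw [e, abs_le]
    constructor <;> linarith
  · rw [Finset.mem_singleton.1 e, abs_le]
    push_cast
    constructor <;> linarith

theorem expect_roundCoord_exp_le {v t C : ℝ} (F : ℤ → ℝ)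
    (h0 : F ⌊v⌋ ≤ t * (-Int.fract v)) (h1 : F (⌊v⌋ + 1) ≤ t * (1 - Int.fract v))
    (hC : t ^ 2 / 8 ≤ C) :
    expect (roundCoord v) (fun w => ENNReal.ofReal (Real.exp (F w)))
      ≤ ENNReal.ofReal (Real.exp C) := by
  have hf0 := Int.fract_nonneg v
  have hf1 := Int.fract_lt_one v
  have hf1' : 0 ≤ 1 - Int.fract v := by linarith
  rw [expect_roundCoord, ← ENNReal.ofReal_mul hf1', ← ENNReal.ofReal_mul hf0,
    ← ENNReal.ofReal_add (by positivity) (by positivity)]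
  apply ENNReal.ofReal_le_ofReal
  calc _ ≤ (1 - Int.fract v) * Real.exp (t * (-Int.fract v))
          + Int.fract v * Real.exp (t * (1 - Int.fract v)) := by gcongr
    _ ≤ Real.exp (t ^ 2 / 8) := hoeffding_two_point hf0 hf1.le t
    _ ≤ Real.exp C := Real.exp_le_exp.2 hC

theorem expect_roundCoord_exp_sub_le (v t : ℝ) :
    expect (roundCoord v) (fun w => ENNReal.ofReal (Real.exp (t * (w - v))))
      ≤ ENNReal.ofReal (Real.exp (t ^ 2 / 8)) := by
  have hv := Int.floor_add_fract v
  refine expect_roundCoord_exp_le (t := t) (fun w => t * (w - v)) (le_of_eq ?_) (le_of_eq ?_) le_rfl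
  · congr 1
    linarith
  · push_cast
    congr 1
    linarith

/-- The secant of `x²` through `a = ⌊v⌋` and `a + 1` has slope `2a + 1` and exceeds `v²` at `v` by
at most `1/4`. So `w² - v² - 1/4 ≤ (2a + 1)(w - v)` at both values, and Hoeffding applies with the
rescaled `t`. -/
theorem expect_roundCoord_exp_sq_le (v : ℝ) {t : ℝ} (ht : 0 ≤ t) :
    expect (roundCoord v) (fun w => ENNReal.ofReal (Real.exp (t * (w ^ 2 - v ^ 2 - 1 / 4))))
      ≤ ENNReal.ofReal (Real.exp (t ^ 2 * (2 * |v| + 1) ^ 2 / 8)) := by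
  have hf0 := Int.fract_nonneg v
  have hf1 := Int.fract_lt_one v
  have hv := Int.floor_add_fract v
  have hle : ∀ a p : ℝ, a + p = v → a ^ 2 - v ^ 2 - 1 / 4 ≤ (2 * a + 1) * (-p) ∧
      (a + 1) ^ 2 - v ^ 2 - 1 / 4 ≤ (2 * a + 1) * (1 - p) := by
    rintro a p rfl
    constructor <;> nlinarith [sq_nonneg (p - 1 / 2)]
  obtain ⟨hle0, hle1⟩ := hle _ _ hv
  set a : ℝ := (⌊v⌋ : ℝ) with ha
  refine expect_roundCoord_exp_le (t := t * (2 * a + 1)) (fun w => t * (w ^ 2 - v ^ 2 - 1 / 4))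
    ?_ ?_ ?_
  · rw [mul_assoc]
    exact mul_le_mul_of_nonneg_left hle0 ht
  · rw [mul_assoc]
    push_cast
    exact mul_le_mul_of_nonneg_left hle1 ht
  · have h : (2 * a + 1) ^ 2 ≤ (2 * |v| + 1) ^ 2 := by
      apply sq_le_sq'
      · linarith [neg_abs_le v]
      · linarith [le_abs_self v]
    rw [mul_pow]
    gcongr

theorem norm_intVec_sq {d : ℕ} (w : Fin d → ℤ) : ‖intVec w‖ ^ 2 = ∑ j, (w j : ℝ) ^ 2 := by
  rw [EuclideanSpace.real_norm_sq_eq]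
  simp [intVec]

/-- Cauchy–Schwarz in the form `‖u‖₁ ≤ √d ‖u‖`, after expanding; this is the source of `r + √d / 2`
in the acceptance bound. -/
theorem sum_two_mul_abs_add_one_sq_le {d : ℕ} {r : ℝ} (u : EuclideanSpace ℝ (Fin d))
    (hu : ‖u‖ ≤ r) : ∑ j, (2 * |u j| + 1) ^ 2 ≤ 4 * (r + √(d : ℝ) / 2) ^ 2 := by
  have hr : 0 ≤ r := (norm_nonneg u).trans hu
  have hd : √(d : ℝ) ^ 2 = d := Real.sq_sqrt (Nat.cast_nonneg d)
  have hsq : ∑ j, |u j| ^ 2 ≤ r ^ 2 := by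
    have h := EuclideanSpace.real_norm_sq_eq u
    simp_rw [sq_abs]
    rw [← h]
    gcongr
  have h1 : ∑ j, |u j| ≤ √(d : ℝ) * r := by
    refine (pow_le_pow_iff_left₀ (by positivity) (by positivity) two_ne_zero).1 ?_
    calc (∑ j, |u j|) ^ 2 ≤ (Finset.univ : Finset (Fin d)).card * ∑ j, |u j| ^ 2 :=
          sq_sum_le_card_mul_sum_sq
      _ ≤ d * r ^ 2 := by
          rw [Finset.card_univ, Fintype.card_fin]
          gcongr
      _ = (√(d : ℝ) * r) ^ 2 := by rw [mul_pow, hd]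
  calc ∑ j, (2 * |u j| + 1) ^ 2 = 4 * ∑ j, |u j| ^ 2 + 4 * ∑ j, |u j| + d := by
        have h : ∀ j, (2 * |u j| + 1) ^ 2 = 4 * |u j| ^ 2 + 4 * |u j| + 1 := fun j => by ring
        simp_rw [h]
        rw [Finset.sum_add_distrib, Finset.sum_add_distrib, Finset.mul_sum, Finset.mul_sum]
        simp
    _ ≤ 4 * r ^ 2 + 4 * (√(d : ℝ) * r) + √(d : ℝ) ^ 2 := by
        rw [hd]
        gcongr
    _ = 4 * (r + √(d : ℝ) / 2) ^ 2 := by ring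

theorem expect_roundVec_exp_norm_sq_le {d : ℕ} {r : ℝ} (u : EuclideanSpace ℝ (Fin d))
    (hu : ‖u‖ ≤ r) {t : ℝ} (ht : 0 ≤ t) :
    expect (roundVec u) (fun w => ENNReal.ofReal (Real.exp (t * (‖intVec w‖ ^ 2 - r ^ 2 - d / 4))))
      ≤ ENNReal.ofReal (Real.exp (t ^ 2 * (r + √(d : ℝ) / 2) ^ 2 / 2)) := by
  have hle : ∀ w : Fin d → ℤ,
      ENNReal.ofReal (Real.exp (t * (‖intVec w‖ ^ 2 - r ^ 2 - d / 4)))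
        ≤ ∏ j, ENNReal.ofReal (Real.exp (t * ((w j : ℝ) ^ 2 - u j ^ 2 - 1 / 4))) := by
    intro w
    rw [← ENNReal.ofReal_prod_of_nonneg fun _ _ => (Real.exp_pos _).le, ← Real.exp_sum,
      ← Finset.mul_sum]
    apply ENNReal.ofReal_le_ofReal
    apply Real.exp_le_exp.2
    refine mul_le_mul_of_nonneg_left ?_ ht
    rw [Finset.sum_sub_distrib, Finset.sum_sub_distrib, ← norm_intVec_sq,
      ← EuclideanSpace.real_norm_sq_eq u]
    have : ‖u‖ ^ 2 ≤ r ^ 2 := by gcongr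
    simp
    linarith
  refine (expect_mono _ fun w _ => hle w).trans ?_
  rw [roundVec, expect_independent_prod _ fun j (w : ℤ) =>
    ENNReal.ofReal (Real.exp (t * ((w : ℝ) ^ 2 - u j ^ 2 - 1 / 4)))]
  refine (Finset.prod_le_prod' fun j _ => expect_roundCoord_exp_sq_le (u j) ht).trans ?_
  rw [← ENNReal.ofReal_prod_of_nonneg fun _ _ => (Real.exp_pos _).le, ← Real.exp_sum,
    ← Finset.sum_div, ← Finset.mul_sum]
  apply ENNReal.ofReal_le_ofReal
  apply Real.exp_le_exp.2
  have := sum_two_mul_abs_add_one_sq_le u hu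
  calc t ^ 2 * (∑ j, (2 * |u j| + 1) ^ 2) / 8 ≤ t ^ 2 * (4 * (r + √(d : ℝ) / 2) ^ 2) / 8 := by
        gcongr
    _ = t ^ 2 * (r + √(d : ℝ) / 2) ^ 2 / 2 := by ring

/-! ### Rejection probability and the cost of conditioning -/

theorem norm_intVec_le_of_roundVec_ne_zero {d : ℕ} {r : ℝ} (u : EuclideanSpace ℝ (Fin d))
    (hu : ‖u‖ ≤ r) {w : Fin d → ℤ} (hw : roundVec u w ≠ 0) : ‖intVec w‖ ≤ r + √(d : ℝ) := by
  rw [roundVec, independent_apply, Finset.prod_ne_zero_iff] at hw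
  have hd : ‖intVec w - u‖ ≤ √(d : ℝ) := by
    rw [EuclideanSpace.norm_eq]
    apply Real.sqrt_le_sqrt
    calc ∑ j, ‖(intVec w - u) j‖ ^ 2 ≤ ∑ _j : Fin d, (1 : ℝ) := by
          refine Finset.sum_le_sum fun j _ => ?_
          have : ‖(intVec w - u) j‖ ≤ 1 := by
            simpa [intVec] using abs_sub_le_one_of_roundCoord_ne_zero (hw j (Finset.mem_univ j))
          nlinarith [norm_nonneg ((intVec w - u) j)]
      _ = d := by simp
  calc ‖intVec w‖ = ‖u + (intVec w - u)‖ := by congr 1; abel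
    _ ≤ ‖u‖ + ‖intVec w - u‖ := norm_add_le _ _
    _ ≤ r + √(d : ℝ) := add_le_add hu hd

/-- Randomized rounding is rejected with probability at most `β`. -/
theorem tsum_compl_accepted_le {d : ℕ} {r β : ℝ} (hr : 0 < r) (hβ0 : 0 ≤ β) (hβ1 : β < 1)
    (u : EuclideanSpace ℝ (Fin d)) (hu : ‖u‖ ≤ r) :
    ∑' w, (accepted d r β)ᶜ.indicator (roundVec u) w ≤ ENNReal.ofReal β := by
  classical
  rcases hβ0.eq_or_lt with rfl | hβ
  · rw [ENNReal.ofReal_zero, nonpos_iff_eq_zero, ENNReal.tsum_eq_zero]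
    intro w
    rw [Set.indicator_apply_eq_zero]
    intro hw
    by_contra h0
    exact hw ⟨norm_intVec_le_of_roundVec_ne_zero u hu h0, fun h => absurd rfl h⟩
  set B := r + √(d : ℝ) / 2 with hB
  have hB0 : 0 < B := by positivity
  have hlog : 0 ≤ Real.log (1 / β) := Real.log_nonneg (by rw [le_div_iff₀ hβ]; linarith)
  set τ := √(2 * Real.log (1 / β)) with hτ
  have hτ0 : 0 ≤ τ := Real.sqrt_nonneg _
  have hτ2 : τ ^ 2 = 2 * Real.log (1 / β) := Real.sq_sqrt (by positivity)
  have ht : 0 ≤ τ / B := by positivity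
  -- Chernoff's bound for `‖w‖²` with the optimal parameter `τ / B`; the exponent becomes `τ² / 2 -
  -- τ² = log β`.
  have hbound : ∀ w, (accepted d r β)ᶜ.indicator (roundVec u) w ≤ roundVec u w *
      (ENNReal.ofReal (Real.exp (τ / B * (‖intVec w‖ ^ 2 - r ^ 2 - d / 4))) *
        ENNReal.ofReal (Real.exp (-τ ^ 2))) := by
    intro w
    rw [Set.indicator_apply]
    split_ifs with hw
    · by_cases h0 : roundVec u w = 0
      · rw [h0, zero_mul]
      apply le_mul_of_one_le_right zero_le
      rw [← ENNReal.ofReal_mul (Real.exp_pos _).le, ← Real.exp_add, ENNReal.one_le_ofReal]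
      apply Real.one_le_exp
      have hnot : √(r ^ 2 + (d : ℝ) / 4 + τ * B) < ‖intVec w‖ := by
        by_contra hle
        push Not at hle
        exact hw ⟨norm_intVec_le_of_roundVec_ne_zero u hu h0, fun _ => hle⟩
      have hsq : r ^ 2 + (d : ℝ) / 4 + τ * B < ‖intVec w‖ ^ 2 :=
        (Real.sqrt_lt' ((Real.sqrt_nonneg _).trans_lt hnot)).1 hnot
      have h1 : τ / B * (τ * B) = τ ^ 2 := by field_simp
      have h2 : τ / B * (τ * B) ≤ τ / B * (‖intVec w‖ ^ 2 - r ^ 2 - d / 4) :=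
        mul_le_mul_of_nonneg_left (by linarith) ht
      linarith
    · exact zero_le
  calc _ ≤ expect (roundVec u) fun w =>
        ENNReal.ofReal (Real.exp (τ / B * (‖intVec w‖ ^ 2 - r ^ 2 - d / 4))) *
        ENNReal.ofReal (Real.exp (-τ ^ 2)) := ENNReal.tsum_le_tsum hbound
    _ ≤ ENNReal.ofReal (Real.exp ((τ / B) ^ 2 * B ^ 2 / 2)) *
          ENNReal.ofReal (Real.exp (-τ ^ 2)) := by
        rw [expect_mul_const]
        gcongr
        exact expect_roundVec_exp_norm_sq_le u hu ht
    _ = ENNReal.ofReal β := by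
        rw [← ENNReal.ofReal_mul (Real.exp_pos _).le, ← Real.exp_add]
        congr 1
        have : (τ / B) ^ 2 * B ^ 2 / 2 + -τ ^ 2 = Real.log β := by
          rw [div_pow, div_mul_cancel₀ _ (by positivity), hτ2, one_div, Real.log_inv]
          ring
        rw [this, Real.exp_log hβ]

/-- Conditioning divides by the acceptance probability, which is at least `1 - β`. This transfers
bounds from independent coordinates to the conditioned law, whose coordinates are dependent. -/
theorem expect_condRound_le {d : ℕ} {r β : ℝ} (hr : 0 < r) (hβ0 : 0 ≤ β) (hβ1 : β < 1)
    (u : EuclideanSpace ℝ (Fin d)) (hu : ‖u‖ ≤ r) (F : (Fin d → ℤ) → ℝ≥0∞) :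
    expect (condRound r β u hu) F ≤ ENNReal.ofReal (1 - β)⁻¹ * expect (roundVec u) F := by
  have hpos : 0 < 1 - β := by linarith
  have hsum : ∑' w, (accepted d r β).indicator (roundVec u) w
      + ∑' w, (accepted d r β)ᶜ.indicator (roundVec u) w = 1 := by
    rw [← ENNReal.tsum_add, ← (roundVec u).tsum_coe]
    exact tsum_congr fun w => Set.indicator_self_add_compl_apply _ _ _
  have hZ : ENNReal.ofReal (1 - β) ≤ ∑' w, (accepted d r β).indicator (roundVec u) w := by
    have h := tsum_compl_accepted_le hr hβ0 hβ1 u hu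
    rw [ENNReal.ofReal_sub _ hβ0, ENNReal.ofReal_one, tsub_le_iff_right, ← hsum]
    gcongr
  rw [← expect_const_mul]
  refine ENNReal.tsum_le_tsum fun w => ?_
  rw [condRound, PMF.filter_apply, ENNReal.ofReal_inv_of_pos hpos, ← mul_assoc]
  have h1 : (accepted d r β).indicator (roundVec u) w ≤ roundVec u w :=
    Set.indicator_le_self _ _ _
  gcongr

theorem expect_condRound_exp_le {d : ℕ} {r β : ℝ} (hr : 0 < r) (hβ0 : 0 ≤ β) (hβ1 : β < 1)
    (u : EuclideanSpace ℝ (Fin d)) (hu : ‖u‖ ≤ r) (j : Fin d) (t : ℝ) :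
    expect (condRound r β u hu) (fun w => ENNReal.ofReal (Real.exp (t * (w j - u j))))
      ≤ ENNReal.ofReal ((1 - β)⁻¹ * Real.exp (t ^ 2 / 8)) := by
  have hpos : 0 < 1 - β := by linarith
  refine (expect_condRound_le hr hβ0 hβ1 u hu _).trans ?_
  rw [ENNReal.ofReal_mul (by positivity), roundVec,
    expect_independent_coord _ j fun a : ℤ => ENNReal.ofReal (Real.exp (t * (a - u j)))]
  gcongr
  exact expect_roundCoord_exp_sub_le _ _

theorem ofReal_exp_sum {ι : Type*} (s : Finset ι) (f : ι → ℝ) :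
    ENNReal.ofReal (Real.exp (∑ i ∈ s, f i)) = ∏ i ∈ s, ENNReal.ofReal (Real.exp (f i)) := by
  rw [Real.exp_sum, ENNReal.ofReal_prod_of_nonneg fun _ _ => (Real.exp_pos _).le]

theorem expect_roundedInputs_exp_le {n k : ℕ} (P : Params) (ξ : Fin (2 ^ k) → ℤˣ)
    (x : Fin n → EuclideanSpace ℝ (Fin (2 ^ k))) (j : Fin (2 ^ k)) (t : ℝ) :
    expect (roundedInputs P ξ x) (fun w => ENNReal.ofReal
        (Real.exp (t * (∑ i, (w i j : ℝ) - ∑ i, flatClip P ξ (x i) j))))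
      ≤ ENNReal.ofReal (((1 - P.β)⁻¹ * Real.exp (t ^ 2 / 8)) ^ n) := by
  have hpos : 0 < 1 - P.β := by linarith [P.β_lt_one]
  simp only [← Finset.sum_sub_distrib, Finset.mul_sum, ofReal_exp_sum]
  rw [roundedInputs, expect_independent_prod _ fun i (w : Fin (2 ^ k) → ℤ) =>
    ENNReal.ofReal (Real.exp (t * ((w j : ℝ) - flatClip P ξ (x i) j)))]
  refine (Finset.prod_le_prod' fun i _ => expect_condRound_exp_le (div_pos P.c_pos P.γ_pos)
    P.β_nonneg P.β_lt_one _ (norm_flatClip_le P ξ (x i)) j t).trans ?_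
  rw [Finset.prod_const, Finset.card_univ, Fintype.card_fin, ENNReal.ofReal_pow (by positivity)]

theorem expect_noise_exp_le (P : Params) (n d : ℕ) (j : Fin d) (t : ℝ) :
    expect (noise P n d) (fun u => ENNReal.ofReal (Real.exp (t * u j)))
      ≤ ENNReal.ofReal (Real.exp (t ^ 2 * (P.σ / P.γ) ^ 2 / 2) ^ n) := by
  rw [noise, expect_independent_coord _ j fun a : ℤ => ENNReal.ofReal (Real.exp (t * a)), iterSum,
    expect_map]
  simp only [Int.cast_sum, Finset.mul_sum, ofReal_exp_sum]
  rw [expect_independent_prod _ fun _ (a : ℤ) => ENNReal.ofReal (Real.exp (t * a)),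
    Finset.prod_const, Finset.card_univ, Fintype.card_fin, ENNReal.ofReal_pow (Real.exp_pos _).le]
  gcongr
  exact expect_exp_discreteGaussian_le _ t

/-- The deviation of a coordinate of the integer sum from its target is subgaussian, up to the
factor that is lost by conditioning. -/
theorem expect_exp_deviation_le {n k : ℕ} (P : Params) (ξ : Fin (2 ^ k) → ℤˣ)
    (x : Fin n → EuclideanSpace ℝ (Fin (2 ^ k))) (j : Fin (2 ^ k)) (t : ℝ) :
    expect (roundedInputs P ξ x) (fun w => expect (noise P n (2 ^ k)) fun u =>
        ENNReal.ofReal (Real.exp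
          (t * (((∑ i, w i + u) j : ℤ) - ∑ i, flatClip P ξ (x i) j))))
      ≤ ENNReal.ofReal ((1 - P.β)⁻¹ ^ n *
          Real.exp (t ^ 2 * (n * (1 + (P.σ / P.γ) ^ 2)))) := by
  have hpos : 0 < 1 - P.β := by linarith [P.β_lt_one]
  have hsplit : ∀ (w : Fin n → Fin (2 ^ k) → ℤ) (u : Fin (2 ^ k) → ℤ),
      ENNReal.ofReal (Real.exp
          (t * (((∑ i, w i + u) j : ℤ) - ∑ i, flatClip P ξ (x i) j)))
        = ENNReal.ofReal (Real.exp (t * (∑ i, (w i j : ℝ) - ∑ i, flatClip P ξ (x i) j)))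
          * ENNReal.ofReal (Real.exp (t * u j)) := by
    intro w u
    rw [← ENNReal.ofReal_mul (Real.exp_pos _).le, ← Real.exp_add]
    congr 2
    simp only [Pi.add_apply, Finset.sum_apply]
    push_cast
    ring
  simp only [hsplit, expect_const_mul]
  rw [expect_mul_const]
  calc _ ≤ ENNReal.ofReal (((1 - P.β)⁻¹ * Real.exp (t ^ 2 / 8)) ^ n) *
        ENNReal.ofReal (Real.exp (t ^ 2 * (P.σ / P.γ) ^ 2 / 2) ^ n) := by
        gcongr
        · exact expect_roundedInputs_exp_le P ξ x j t
        · exact expect_noise_exp_le P n (2 ^ k) j t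
    _ ≤ _ := by
        rw [← ENNReal.ofReal_mul (by positivity)]
        apply ENNReal.ofReal_le_ofReal
        rw [mul_pow, mul_assoc, ← Real.exp_nat_mul, ← Real.exp_nat_mul, ← Real.exp_add]
        gcongr
        have h1 : 0 ≤ n * (t ^ 2 * (7 / 8 : ℝ)) := by positivity
        have h2 : 0 ≤ n * (t ^ 2 * (P.σ / P.γ) ^ 2 / 2) := by positivity
        linarith

/-! ### Flattening spreads every fixed vector -/

theorem walshHadamard_sq (k : ℕ) (i j : Fin (2 ^ k)) :
    walshHadamard k i j ^ 2 = 1 / ((2 ^ k : ℕ) : ℝ) := by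
  induction k with
  | zero =>
    obtain rfl : i = j := Subsingleton.elim (α := Fin 1) i j
    rw [walshHadamard, Matrix.one_apply_eq]
    norm_num
  | succ k ih =>
    simp only [walshHadamard, Matrix.smul_apply, Matrix.reindex_apply, Matrix.submatrix_apply,
      smul_eq_mul, mul_pow]
    have h2 : (1 / √2 : ℝ) ^ 2 = 1 / 2 := by
      rw [div_pow, Real.sq_sqrt (by norm_num), one_pow]
    rw [h2]
    generalize (finSumFinEquiv.trans (finCongr _)).symm i = i'
    generalize (finSumFinEquiv.trans (finCongr _)).symm j = j'
    rcases i' with i' | i' <;> rcases j' with j' | j' <;>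
      simp only [Matrix.fromBlocks_apply₁₁, Matrix.fromBlocks_apply₁₂, Matrix.fromBlocks_apply₂₁,
        Matrix.fromBlocks_apply₂₂, Matrix.neg_apply, neg_sq, ih] <;>
      push_cast <;> rw [pow_succ] <;> field_simp

theorem uniformOfFintype_pi_eq_independent {α : Type*} [Fintype α] [Nonempty α] (d : ℕ) :
    PMF.uniformOfFintype (Fin d → α) = independent fun _ : Fin d => PMF.uniformOfFintype α := by
  classical
  ext f
  simp [independent_apply, PMF.uniformOfFintype_apply, ENNReal.inv_pow]

theorem expect_uniform_sign_exp_le (b : ℝ) :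
    expect (PMF.uniformOfFintype ℤˣ) (fun u => ENNReal.ofReal (Real.exp (b * ((u : ℤ) : ℝ))))
      ≤ ENNReal.ofReal (Real.exp (b ^ 2 / 2)) := by
  have h2 : (2 : ℝ≥0∞)⁻¹ = ENNReal.ofReal (1 / 2) := by
    rw [one_div, ENNReal.ofReal_inv_of_pos (by norm_num)]
    simp
  rw [expect, tsum_fintype, UnitsInt.univ, Finset.sum_pair (by decide)]
  simp only [PMF.uniformOfFintype_apply, Fintype.card_units_int, Nat.cast_ofNat, h2, Units.val_one,
    Units.val_neg, Int.cast_one, Int.cast_neg, mul_one, mul_neg]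
  rw [← ENNReal.ofReal_mul (by norm_num), ← ENNReal.ofReal_mul (by norm_num),
    ← ENNReal.ofReal_add (by positivity) (by positivity)]
  apply ENNReal.ofReal_le_ofReal
  have h := Real.cosh_le_exp_half_sq b
  rw [Real.cosh_eq] at h
  linarith

theorem expect_uniform_signs_exp_le {d : ℕ} (b : Fin d → ℝ) :
    expect (PMF.uniformOfFintype (Fin d → ℤˣ))
        (fun ξ => ENNReal.ofReal (Real.exp (∑ l, b l * ((ξ l : ℤ) : ℝ))))
      ≤ ENNReal.ofReal (Real.exp ((∑ l, b l ^ 2) / 2)) := by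
  rw [uniformOfFintype_pi_eq_independent, Finset.sum_div]
  simp only [ofReal_exp_sum]
  rw [expect_independent_prod _ fun l (u : ℤˣ) =>
    ENNReal.ofReal (Real.exp (b l * ((u : ℤ) : ℝ)))]
  exact Finset.prod_le_prod' fun l _ => expect_uniform_sign_exp_le (b l)

theorem clip_eq_smul {d : ℕ} (P : Params) {x : EuclideanSpace ℝ (Fin d)} (hx : ‖x‖ ≤ P.c) :
    clip P x = P.γ⁻¹ • x := by
  rcases eq_or_ne x 0 with rfl | h0
  · simp [clip]
  · have h1 : 1 ≤ P.c / ‖x‖ := (one_le_div (norm_pos_iff.2 h0)).2 hx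
    rw [clip, min_eq_left h1, mul_one, one_div]

/-- The flattened and rescaled sum, which the integer sum of the clients estimates. -/
def target {k : ℕ} (P : Params) (ξ : Fin (2 ^ k) → ℤˣ) (v : EuclideanSpace ℝ (Fin (2 ^ k))) :
    Fin (2 ^ k) → ℝ :=
  flatten ξ *ᵥ (P.γ⁻¹ • v.ofLp)

theorem sum_flatClip_eq {n k : ℕ} (P : Params) (ξ : Fin (2 ^ k) → ℤˣ)
    {x : Fin n → EuclideanSpace ℝ (Fin (2 ^ k))} (hx : ∀ i, ‖x i‖ ≤ P.c) (j : Fin (2 ^ k)) :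
    ∑ i, flatClip P ξ (x i) j = target P ξ (∑ i, x i) j := by
  simp only [flatClip, clip_eq_smul P (hx _), target, WithLp.ofLp_smul, WithLp.ofLp_sum]
  rw [Finset.smul_sum, Matrix.mulVec_sum, Finset.sum_apply]

theorem target_apply {k : ℕ} (P : Params) (ξ : Fin (2 ^ k) → ℤˣ)
    (v : EuclideanSpace ℝ (Fin (2 ^ k))) (j : Fin (2 ^ k)) :
    target P ξ v j = ∑ l, walshHadamard k j l * (P.γ⁻¹ * v l) * ((ξ l : ℤ) : ℝ) := by
  simp only [target, flatten, signMatrix, Matrix.mulVec, dotProduct, Matrix.mul_diagonal,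
    Pi.smul_apply, smul_eq_mul]
  exact Finset.sum_congr rfl fun l _ => by ring

/-- A coordinate of the target is a Rademacher sum whose squared coefficients add up to `‖v‖² / (d
γ²)`, because every squared Hadamard entry is `1/d`. -/
theorem expect_exp_target_le {k : ℕ} (P : Params) (v : EuclideanSpace ℝ (Fin (2 ^ k)))
    (j : Fin (2 ^ k)) (t : ℝ) :
    expect (PMF.uniformOfFintype (Fin (2 ^ k) → ℤˣ))
        (fun ξ => ENNReal.ofReal (Real.exp (t * target P ξ v j)))
      ≤ ENNReal.ofReal
          (Real.exp (t ^ 2 * (‖v‖ ^ 2 / (((2 ^ k : ℕ) : ℝ) * P.γ ^ 2)) / 2)) := by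
  have h := expect_uniform_signs_exp_le fun l => t * (walshHadamard k j l * (P.γ⁻¹ * v l))
  simp only [target_apply, Finset.mul_sum, ← mul_assoc] at h ⊢
  refine h.trans_eq ?_
  congr 4
  simp only [mul_pow, walshHadamard_sq]
  rw [EuclideanSpace.real_norm_sq_eq, ← Finset.mul_sum]
  field_simp

/-- Unflattening is an isometry, so the error may be computed in flattened coordinates. -/
theorem norm_server_sub_sq {k : ℕ} (P : Params) (ξ : Fin (2 ^ k) → ℤˣ)
    (z : Fin (2 ^ k) → ZMod P.m) (v : EuclideanSpace ℝ (Fin (2 ^ k))) :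
    ‖server P ξ z - v‖ ^ 2
      = P.γ ^ 2 * ∑ j, (((z j).valMinAbs : ℝ) - target P ξ v j) ^ 2 := by
  have hγ := P.γ_pos.ne'
  set F := flatten ξ with hF
  have hFt : signMatrix ξ * (walshHadamard k)ᵀ = Fᵀ := by
    rw [hF, flatten, Matrix.transpose_mul, signMatrix, Matrix.diagonal_transpose]
  have hFF : Fᵀ * F = 1 := flatten_transpose_mul_self ξ
  have hFF' : F * Fᵀ = 1 := mul_eq_one_comm.1 hFF
  set b : Fin (2 ^ k) → ℝ := fun j => ((z j).valMinAbs : ℝ) with hb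
  have hv : v.ofLp = P.γ • (Fᵀ *ᵥ target P ξ v) := by
    rw [target, ← hF, Matrix.mulVec_smul, Matrix.mulVec_smul, Matrix.mulVec_mulVec, hFF,
      Matrix.one_mulVec, smul_smul, mul_inv_cancel₀ hγ, one_smul]
  have hs : (server P ξ z - v).ofLp = P.γ • (Fᵀ *ᵥ (b - target P ξ v)) := by
    rw [WithLp.ofLp_sub, hv, server, hFt, WithLp.ofLp_smul, ← smul_sub, Matrix.mulVec_sub]
  have hdot : ∀ a : Fin (2 ^ k) → ℝ, ∑ i, a i ^ 2 = a ⬝ᵥ a := fun a => by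
    simp [dotProduct, sq]
  rw [EuclideanSpace.real_norm_sq_eq, hs]
  simp only [Pi.smul_apply, smul_eq_mul, mul_pow]
  rw [← Finset.mul_sum]
  congr 1
  rw [hdot, Matrix.dotProduct_mulVec, Matrix.vecMul_mulVec, Matrix.transpose_transpose, hFF',
    Matrix.vecMul_one, ← hdot]
  rfl

/-! ### Accuracy -/

theorem sq_le_two_mul_exp {y : ℝ} (hy : 0 ≤ y) : y ^ 2 ≤ 2 * Real.exp y := by
  have := Real.quadratic_le_exp_of_nonneg hy
  nlinarith

theorem exp_abs_le (y : ℝ) : Real.exp |y| ≤ Real.exp y + Real.exp (-y) := by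
  have h1 := Real.exp_pos y
  have h2 := Real.exp_pos (-y)
  rcases abs_choice y with h | h <;> rw [h] <;> linarith

theorem sq_le_exp_add_exp {t : ℝ} (ht : 0 < t) (y : ℝ) :
    y ^ 2 ≤ 2 / t ^ 2 * (Real.exp (t * y) + Real.exp (-t * y)) := by
  have h1 := sq_le_two_mul_exp (abs_nonneg (t * y))
  have h2 := exp_abs_le (t * y)
  rw [sq_abs, mul_pow] at h1
  rw [div_mul_eq_mul_div, le_div_iff₀ (by positivity), neg_mul]
  linarith

theorem sq_valMinAbs_sub_le {m : ℕ} (hm : m ≠ 0) {l : ℝ} (hl : 0 < l) (S : ℤ) :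
    (((S : ZMod m).valMinAbs : ℝ) - S) ^ 2
      ≤ 8 / l ^ 2 * Real.exp (-(l * m / 2)) *
        (Real.exp (2 * l * S) + Real.exp (-(2 * l) * S)) := by
  have : NeZero m := ⟨hm⟩
  by_cases hS : S * 2 ∈ Set.Ioc (-m : ℤ) m
  · rw [(ZMod.valMinAbs_spec _ S).2 ⟨rfl, hS⟩, sub_self, zero_pow two_ne_zero]
    positivity
  have hb := ZMod.natAbs_valMinAbs_le (S : ZMod m)
  have hbig : (m : ℝ) / 2 ≤ |(S : ℝ)| := by
    have : (m : ℤ) ≤ 2 * |S| := by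
      rw [Set.mem_Ioc, not_and_or] at hS
      rcases hS with h | h
      · have := neg_abs_le S; omega
      · have := le_abs_self S; omega
    have : (m : ℝ) ≤ 2 * |(S : ℝ)| := by exact_mod_cast this
    linarith
  have hb2 : |((S : ZMod m).valMinAbs : ℝ)| ≤ (m : ℝ) / 2 := by
    have h2 : 2 * |(S : ZMod m).valMinAbs| ≤ (m : ℤ) := by
      rw [Int.abs_eq_natAbs]
      omega
    have : 2 * |((S : ZMod m).valMinAbs : ℝ)| ≤ (m : ℝ) := by exact_mod_cast h2
    linarith
  -- Outside the window `|S| ≥ m/2 ≥ |valMinAbs|`, so the error is at most `2|S|`; also `l|S| ≤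
  -- 2l|S| - lm/2`, which produces the damping factor.
  have h1 : (((S : ZMod m).valMinAbs : ℝ) - S) ^ 2 ≤ 4 * (S : ℝ) ^ 2 := by
    rw [← sq_abs (((S : ZMod m).valMinAbs : ℝ) - S), ← sq_abs (S : ℝ)]
    have := abs_sub ((S : ZMod m).valMinAbs : ℝ) (S : ℝ)
    nlinarith [abs_nonneg (((S : ZMod m).valMinAbs : ℝ) - S)]
  have h2 := sq_le_two_mul_exp (mul_nonneg hl.le (abs_nonneg (S : ℝ)))
  rw [mul_pow, sq_abs] at h2
  have h3 : Real.exp (l * |(S : ℝ)|) ≤ Real.exp (-(l * m / 2)) * Real.exp |2 * l * S| := by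
    rw [← Real.exp_add, abs_mul, abs_of_pos (by positivity : 0 < 2 * l)]
    apply Real.exp_le_exp.2
    nlinarith
  have h4 := exp_abs_le (2 * l * (S : ℝ))
  rw [← neg_mul] at h4
  calc _ ≤ 4 * (S : ℝ) ^ 2 := h1
    _ = 4 / l ^ 2 * (l ^ 2 * (S : ℝ) ^ 2) := by field_simp
    _ ≤ 4 / l ^ 2 * (2 * (Real.exp (-(l * m / 2)) *
        (Real.exp (2 * l * S) + Real.exp (-(2 * l) * S)))) := by
        refine mul_le_mul_of_nonneg_left (h2.trans ?_) (by positivity)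
        refine mul_le_mul_of_nonneg_left (h3.trans ?_) (by positivity)
        exact mul_le_mul_of_nonneg_left h4 (by positivity)
    _ = _ := by ring

/-- The joint law of the shared signs and of the sum of the clients' outputs over the integers. -/
def signsAndSum {n k : ℕ} (P : Params) (x : Fin n → EuclideanSpace ℝ (Fin (2 ^ k))) :
    PMF ((Fin (2 ^ k) → ℤˣ) × (Fin (2 ^ k) → ℤ)) :=
  (PMF.uniformOfFintype (Fin (2 ^ k) → ℤˣ)).bind fun ξ =>
    (roundedInputs P ξ x).bind fun w => (noise P n (2 ^ k)).map fun u => (ξ, ∑ i, w i + u)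

theorem system_eq_map {n k : ℕ} (P : Params) (x : Fin n → EuclideanSpace ℝ (Fin (2 ^ k))) :
    system P x = (signsAndSum P x).map fun a => serverInt P a.1 a.2 := by
  rw [system_eq, signsAndSum, PMF.map_bind]
  simp only [PMF.map_bind, PMF.map_comp]
  rfl

/-- The bound for the moment generating function of the deviations of the integer sum. -/
def deviationBound (P : Params) (n : ℕ) (t : ℝ) : ℝ :=
  (1 - P.β)⁻¹ ^ n * Real.exp (t ^ 2 * (n * (1 + (P.σ / P.γ) ^ 2)))

theorem deviationBound_pos (P : Params) (n : ℕ) (t : ℝ) : 0 < deviationBound P n t := by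
  have hpos : 0 < 1 - P.β := by linarith [P.β_lt_one]
  unfold deviationBound
  positivity

theorem deviationBound_neg (P : Params) (n : ℕ) (t : ℝ) :
    deviationBound P n (-t) = deviationBound P n t := by
  simp [deviationBound]

section

variable {n k : ℕ} (P : Params) {x : Fin n → EuclideanSpace ℝ (Fin (2 ^ k))}

theorem expect_signsAndSum_sub_target_le (hx : ∀ i, ‖x i‖ ≤ P.c) (j : Fin (2 ^ k)) (t : ℝ) :
    expect (signsAndSum P x) (fun a =>
        ENNReal.ofReal (Real.exp (t * ((a.2 j : ℤ) - target P a.1 (∑ i, x i) j))))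
      ≤ ENNReal.ofReal (deviationBound P n t) := by
  simp only [signsAndSum, expect_bind, expect_map]
  refine expect_le_const _ fun ξ _ => ?_
  rw [← sum_flatClip_eq P ξ hx]
  exact expect_exp_deviation_le P ξ x j t

/-- The deviation bound holds uniformly in the signs, so the expectation over them only has to
control the target. -/
theorem expect_signsAndSum_le (hx : ∀ i, ‖x i‖ ≤ P.c) (j : Fin (2 ^ k)) (t : ℝ) :
    expect (signsAndSum P x) (fun a => ENNReal.ofReal (Real.exp (t * (a.2 j : ℤ))))
      ≤ ENNReal.ofReal (deviationBound P n t * Real.exp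
          (t ^ 2 * (‖∑ i, x i‖ ^ 2 / (((2 ^ k : ℕ) : ℝ) * P.γ ^ 2)) / 2)) := by
  have hsplit : ∀ (ξ : Fin (2 ^ k) → ℤˣ) (w : Fin n → Fin (2 ^ k) → ℤ) (u : Fin (2 ^ k) → ℤ),
      ENNReal.ofReal (Real.exp (t * (((∑ i, w i + u) j : ℤ) : ℝ)))
        = ENNReal.ofReal (Real.exp
            (t * (((∑ i, w i + u) j : ℤ) - ∑ i, flatClip P ξ (x i) j))) *
          ENNReal.ofReal (Real.exp (t * target P ξ (∑ i, x i) j)) := by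
    intro ξ w u
    rw [← ENNReal.ofReal_mul (Real.exp_pos _).le, ← Real.exp_add, sum_flatClip_eq P ξ hx]
    congr 2
    ring
  simp only [signsAndSum, expect_bind, expect_map]
  refine (expect_mono (G := fun ξ => ENNReal.ofReal (deviationBound P n t) *
    ENNReal.ofReal (Real.exp (t * target P ξ (∑ i, x i) j))) _ fun ξ _ => ?_).trans ?_
  · simp_rw [hsplit ξ, expect_mul_const]
    gcongr
    exact expect_exp_deviation_le P ξ x j t
  rw [expect_const_mul, ENNReal.ofReal_mul (deviationBound_pos P n t).le]
  exact mul_le_mul_right (expect_exp_target_le P _ j t) _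

/-- `(a + b)² ≤ 2a² + 2b²` separates deviation from wrap-around. The free parameters `t` and `l`
serve the two parts independently. -/
theorem expect_sq_error_le (hm : P.m ≠ 0) (hx : ∀ i, ‖x i‖ ≤ P.c) {t l : ℝ} (ht : 0 < t)
    (hl : 0 < l) (j : Fin (2 ^ k)) :
    expect (signsAndSum P x) (fun a => ENNReal.ofReal
        ((((a.2 j : ZMod P.m).valMinAbs : ℝ) - target P a.1 (∑ i, x i) j) ^ 2))
      ≤ ENNReal.ofReal (8 / t ^ 2 * deviationBound P n t +
          32 / l ^ 2 * Real.exp (-(l * P.m / 2)) * (deviationBound P n (2 * l) * Real.exp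
            ((2 * l) ^ 2 * (‖∑ i, x i‖ ^ 2 / (((2 ^ k : ℕ) : ℝ) * P.γ ^ 2)) / 2))) := by
  set v := ∑ i, x i with hv
  set D := deviationBound P n (2 * l) * Real.exp
            ((2 * l) ^ 2 * (‖v‖ ^ 2 / (((2 ^ k : ℕ) : ℝ) * P.γ ^ 2)) / 2) with hD
  have hD0 : 0 < D := mul_pos (deviationBound_pos _ _ _) (Real.exp_pos _)
  have hM0 := deviationBound_pos P n t
  set A : ℝ := 4 / t ^ 2 with hA
  set B : ℝ := 16 / l ^ 2 * Real.exp (-(l * P.m / 2)) with hB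
  have hA0 : 0 < A := by positivity
  have hB0 : 0 < B := by positivity
  have hpt : ∀ a : (Fin (2 ^ k) → ℤˣ) × (Fin (2 ^ k) → ℤ),
      ENNReal.ofReal ((((a.2 j : ZMod P.m).valMinAbs : ℝ) - target P a.1 v j) ^ 2)
        ≤ ENNReal.ofReal A * (ENNReal.ofReal (Real.exp (t * ((a.2 j : ℤ) - target P a.1 v j)))
            + ENNReal.ofReal (Real.exp (-t * ((a.2 j : ℤ) - target P a.1 v j))))
          + ENNReal.ofReal B * (ENNReal.ofReal (Real.exp (2 * l * (a.2 j : ℤ)))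
            + ENNReal.ofReal (Real.exp (-(2 * l) * (a.2 j : ℤ)))) := by
    intro a
    rw [← ENNReal.ofReal_add (by positivity) (by positivity),
      ← ENNReal.ofReal_add (by positivity) (by positivity), ← ENNReal.ofReal_mul hA0.le,
      ← ENNReal.ofReal_mul hB0.le, ← ENNReal.ofReal_add (by positivity) (by positivity)]
    apply ENNReal.ofReal_le_ofReal
    have h1 := sq_le_exp_add_exp ht ((a.2 j : ℤ) - target P a.1 v j)
    have h2 := sq_valMinAbs_sub_le hm hl (a.2 j)
    have h3 : (((a.2 j : ZMod P.m).valMinAbs : ℝ) - target P a.1 v j) ^ 2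
        ≤ 2 * (((a.2 j : ℤ) : ℝ) - target P a.1 v j) ^ 2
          + 2 * (((a.2 j : ZMod P.m).valMinAbs : ℝ) - (a.2 j : ℤ)) ^ 2 := by
      nlinarith [sq_nonneg ((((a.2 j : ZMod P.m).valMinAbs : ℝ) - (a.2 j : ℤ))
        - (((a.2 j : ℤ) : ℝ) - target P a.1 v j))]
    have hA' : A = 2 * (2 / t ^ 2) := by rw [hA]; ring
    have hB' : B = 2 * (8 / l ^ 2 * Real.exp (-(l * P.m / 2))) := by rw [hB]; ring
    rw [hA', hB', mul_assoc, mul_assoc]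
    linarith
  refine (expect_mono _ fun a _ => hpt a).trans ?_
  rw [expect_add, expect_const_mul, expect_const_mul, expect_add, expect_add]
  have e1 := expect_signsAndSum_sub_target_le P hx j t
  have e2 := expect_signsAndSum_sub_target_le P hx j (-t)
  have e3 := expect_signsAndSum_le P hx j (2 * l)
  have e4 := expect_signsAndSum_le P hx j (-(2 * l))
  rw [deviationBound_neg] at e2 e4
  rw [neg_sq] at e4
  calc _ ≤ ENNReal.ofReal A * (ENNReal.ofReal (deviationBound P n t)
            + ENNReal.ofReal (deviationBound P n t))
          + ENNReal.ofReal B * (ENNReal.ofReal D + ENNReal.ofReal D) := by gcongr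
    _ = _ := by
        rw [← ENNReal.ofReal_add hM0.le hM0.le, ← ENNReal.ofReal_add hD0.le hD0.le,
          ← ENNReal.ofReal_mul hA0.le, ← ENNReal.ofReal_mul hB0.le,
          ← ENNReal.ofReal_add (by positivity) (by positivity)]
        congr 1
        rw [hA, hB]
        ring

theorem meanSquaredError_system_le (hm : P.m ≠ 0) (hx : ∀ i, ‖x i‖ ≤ P.c) {t l : ℝ}
    (ht : 0 < t) (hl : 0 < l) :
    meanSquaredError (system P x) (∑ i, x i)
      ≤ ENNReal.ofReal (P.γ ^ 2 * (((2 ^ k : ℕ) : ℝ) * (8 / t ^ 2 * deviationBound P n t +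
          32 / l ^ 2 * Real.exp (-(l * P.m / 2)) * (deviationBound P n (2 * l) * Real.exp
            ((2 * l) ^ 2 * (‖∑ i, x i‖ ^ 2 / (((2 ^ k : ℕ) : ℝ) * P.γ ^ 2)) / 2))))) := by
  have h1 : meanSquaredError (system P x) (∑ i, x i)
      = ENNReal.ofReal (P.γ ^ 2) * ∑ j, expect (signsAndSum P x) (fun a => ENNReal.ofReal
        ((((a.2 j : ZMod P.m).valMinAbs : ℝ) - target P a.1 (∑ i, x i) j) ^ 2)) := by
    rw [← expect_sum, ← expect_const_mul]
    change expect (system P x) _ = _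
    rw [system_eq_map, expect_map]
    congr 1
    funext a
    rw [serverInt, norm_server_sub_sq, ENNReal.ofReal_mul (sq_nonneg _),
      ENNReal.ofReal_sum_of_nonneg fun _ _ => sq_nonneg _]
  rw [h1, ENNReal.ofReal_mul (sq_nonneg _)]
  gcongr
  refine (Finset.sum_le_sum fun j _ => expect_sq_error_le P hm hx ht hl j).trans_eq ?_
  rw [Finset.sum_const, Finset.card_univ, Fintype.card_fin, nsmul_eq_mul,
    ENNReal.ofReal_mul (Nat.cast_nonneg _), ENNReal.ofReal_natCast]

end

/-! ### Choice of the parameters -/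

theorem one_le_log_two_add {y : ℝ} (hy : 1 ≤ y) : 1 ≤ Real.log (2 + y) := by
  rw [Real.le_log_iff_exp_le (by linarith)]
  linarith [Real.exp_one_lt_d9]

/-- The condition on the modulus with one logarithm of the scale replaced by one of the modulus. -/
theorem log_modulus_mul_le {X m : ℝ} (hX : 1 ≤ X) (h : 100 * X * Real.log (2 + X) ^ 2 ≤ m) :
    4 * Real.log (2 + m) * (X * Real.log (2 + X)) ≤ m := by
  have hℓ := one_le_log_two_add hX
  have hℓX : Real.log (2 + X) ≤ 2 + X := by
    have := Real.log_le_sub_one_of_pos (show 0 < 2 + X by linarith)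
    linarith
  set ℓ := Real.log (2 + X) with hℓdef
  have hXℓ : 0 < X * ℓ ^ 2 := by positivity
  set t := m / (X * ℓ ^ 2) with ht
  have hm : m = t * (X * ℓ ^ 2) := by rw [ht]; field_simp
  have ht100 : 100 ≤ t := by
    rw [ht, le_div_iff₀ hXℓ]
    linarith
  have h1 : 2 + m ≤ (1 + t) * (2 + X) ^ 3 := by
    have h2 : X * ℓ ^ 2 ≤ (2 + X) ^ 3 := by
      calc X * ℓ ^ 2 ≤ (2 + X) * (2 + X) ^ 2 := by gcongr; linarith
        _ = (2 + X) ^ 3 := by ring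
    have h3 : 2 ≤ (2 + X) ^ 3 := by
      calc (2 : ℝ) ≤ (2 + 1) ^ 3 := by norm_num
        _ ≤ _ := by gcongr
    rw [hm]
    nlinarith
  have h4 : Real.log (2 + m) ≤ Real.log (1 + t) + 3 * ℓ := by
    calc Real.log (2 + m) ≤ Real.log ((1 + t) * (2 + X) ^ 3) := by
          apply Real.log_le_log _ h1
          rw [hm]
          positivity
      _ = Real.log (1 + t) + 3 * ℓ := by
          rw [Real.log_mul (by positivity) (by positivity), Real.log_pow, Nat.cast_ofNat]
  have h5 : Real.log (1 + t) ≤ t / 8 + 7 := by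
    have e : Real.log (1 + t) = Real.log ((1 + t) / 8) + Real.log 8 := by
      rw [Real.log_div (by positivity) (by norm_num)]
      ring
    have a := Real.log_le_sub_one_of_pos (show 0 < (1 + t) / 8 by positivity)
    have b := Real.log_le_sub_one_of_pos (show (0 : ℝ) < 8 by norm_num)
    linarith
  have h6 : 4 * Real.log (2 + m) ≤ t * ℓ := by nlinarith
  calc 4 * Real.log (2 + m) * (X * ℓ) ≤ t * ℓ * (X * ℓ) := by gcongr
    _ = m := by rw [hm]; ring

/-- `y` is the numerical and `b` the logarithmic factor: `4` and `log (2 + m)` for `γ`, `2` and `1`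
for `σ`. -/
theorem agreeUpToLog_of_eq {A b y : ℝ} {m : ℕ} {f g : ℝ} (hg : 0 ≤ g) (hy : 1 ≤ y) (hyA : y ≤ A)
    (hm : 1 ≤ m) (hf : f = y * b * g) (hb1 : 1 ≤ b) (hb : b ≤ Real.log (2 + m)) :
    AgreeUpToLog A 2 m f g := by
  have hΛ : 1 ≤ Real.log (2 + m) := one_le_log_two_add (by exact_mod_cast hm)
  have hΛ2 : Real.log (2 + m) ≤ Real.log (2 + m) ^ 2 := by nlinarith
  have hA : 1 ≤ A := hy.trans hyA
  have hf0 : g ≤ f := by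
    rw [hf]
    have : 1 ≤ y * b := by nlinarith
    nlinarith
  constructor
  · rw [hf]
    gcongr
    exact hb.trans hΛ2
  · refine hf0.trans (le_mul_of_one_le_left (hg.trans hf0) ?_)
    nlinarith

theorem modulusScale_eq {n d : ℕ} {ε : ℝ} (hε : 0 < ε) :
    modulusScale n d ε = n + ε * n * √(n : ℝ) / √(d : ℝ) + √(d : ℝ) / ε := by
  have hn : √(n : ℝ) ^ 2 = n := Real.sq_sqrt (Nat.cast_nonneg n)
  have hd : √(d : ℝ) ^ 2 = d := Real.sq_sqrt (Nat.cast_nonneg d)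
  have h : ε ^ 2 * (n : ℝ) ^ 3 / d = (ε * n * √(n : ℝ) / √(d : ℝ)) ^ 2 := by
    rw [div_pow, mul_pow, mul_pow, hn, hd]
    ring
  rw [modulusScale, h, Real.sqrt_sq (by positivity)]

theorem inv_one_sub_pow_le {β K : ℝ} {n : ℕ} (hn : 1 ≤ n) (hβ0 : 0 ≤ β) (hβ : β ≤ 1 / 2)
    (hK : β ≤ K * (1 / (n : ℝ))) : (1 - β)⁻¹ ^ n ≤ Real.exp (2 * K) := by
  have hn0 : (0 : ℝ) < n := by exact_mod_cast hn
  -- `(1 - β)(1 + 2β) ≥ 1` exactly on `0 ≤ β ≤ 1/2`.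
  have h1 : (1 - β)⁻¹ ≤ Real.exp (2 * β) := by
    rw [inv_le_iff_one_le_mul₀ (by linarith)]
    have := Real.add_one_le_exp (2 * β)
    nlinarith
  have h2 : n * β ≤ K := by
    rw [mul_one_div, le_div_iff₀ hn0] at hK
    linarith
  have h0 : 0 ≤ (1 - β)⁻¹ := inv_nonneg.2 (by linarith)
  calc (1 - β)⁻¹ ^ n ≤ Real.exp (2 * β) ^ n := by gcongr
    _ = Real.exp (2 * (n * β)) := by rw [← Real.exp_nat_mul]; congr 1; ring
    _ ≤ Real.exp (2 * K) := by gcongr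

/-! ### Numerical estimates for the parts of the error -/

theorem gaussian_part_le {γ c σ ε N r : ℝ} (hγ : 0 < γ) (hσ : 0 < σ)
    (hr : 0 < r) (hr2 : r ^ 2 = N) (hγn : γ * r ≤ c / ε) (hσr : σ * r ≤ 4 * (c / ε)) :
    γ ^ 2 * (N * (1 + (σ / γ) ^ 2)) ≤ 17 * (c / ε) ^ 2 := by
  have e : γ ^ 2 * (N * (1 + (σ / γ) ^ 2)) = (γ * r) ^ 2 + (σ * r) ^ 2 := by
    rw [← hr2]
    field_simp
  rw [e]
  calc _ ≤ (c / ε) ^ 2 + (4 * (c / ε)) ^ 2 := by gcongr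
    _ = _ := by ring

/-- The exponent of the deviation bound at `2l`, `l = L/m`. Rounding contributes `4 · 1²` and the
noise `4 · 4²`, as `l σ √n / γ = 2 (Lc/(γεm) + Lq/(εm)) ≤ 4`. -/
theorem noise_exponent_le {γ c σ ε N L m q r : ℝ} (hε : 0 < ε) (hγ : 0 < γ) (hσ0 : 0 < σ)
    (hL : 0 < L) (hm : 0 < m) (hr1 : 1 ≤ r) (hr2 : r ^ 2 = N) (hLn : L * N ≤ m)
    (hLd : L * q ≤ ε * m) (hγ1 : L * c ≤ γ * ε * m) (hσ : σ * r = 2 * (c + q * γ) / ε) :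
    (2 * (L / m)) ^ 2 * (N * (1 + (σ / γ) ^ 2)) ≤ 68 := by
  have h1 : L / m * r ≤ 1 := by
    rw [div_mul_eq_mul_div, div_le_one hm]
    have : r ≤ N := by nlinarith
    exact (mul_le_mul_of_nonneg_left this hL.le).trans hLn
  have h2 : L / m * (σ * r) / γ ≤ 4 := by
    rw [hσ, div_le_iff₀ hγ, div_mul_div_comm, div_le_iff₀ (by positivity)]
    nlinarith
  have e : (2 * (L / m)) ^ 2 * (N * (1 + (σ / γ) ^ 2))
      = 4 * ((L / m * r) ^ 2 + (L / m * (σ * r) / γ) ^ 2) := by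
    rw [← hr2]
    ring
  have h0 : 0 ≤ L / m * r := by positivity
  have h0' : 0 ≤ L / m * (σ * r) / γ := by positivity
  rw [e]
  nlinarith

theorem target_exponent_le {γ c N L m q v d : ℝ} (hγ : 0 < γ) (hL : 0 < L) (hm : 0 < m)
    (hq0 : 0 < q) (hq2 : q ^ 2 = d) (hv0 : 0 ≤ v) (hv : v ≤ N * c)
    (hγ2 : L * c * N ≤ γ * m * q) :
    (2 * (L / m)) ^ 2 * (v ^ 2 / (d * γ ^ 2)) / 2 ≤ 2 := by
  have h1 : L / m * v / (q * γ) ≤ 1 := by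
    rw [div_mul_eq_mul_div, div_div, div_le_one (by positivity)]
    have := mul_le_mul_of_nonneg_left hv hL.le
    linarith
  have h0 : 0 ≤ L / m * v / (q * γ) := by positivity
  have e : (2 * (L / m)) ^ 2 * (v ^ 2 / (d * γ ^ 2)) / 2 = 2 * (L / m * v / (q * γ)) ^ 2 := by
    rw [← hq2]
    field_simp
  rw [e]
  nlinarith

theorem wrap_part_le {γ c ε L m : ℝ} (hγ : 0 < γ) (hL : 0 < L)
    (hm : 0 < m) (hγ3 : γ * m ≤ L * (c / ε) * (2 + m)) :
    γ ^ 2 * (1 / (L / m) ^ 2 * ((2 + m) ^ 2)⁻¹) ≤ (c / ε) ^ 2 := by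
  have e : γ ^ 2 * (1 / (L / m) ^ 2 * ((2 + m) ^ 2)⁻¹) = (γ * m / (L * (2 + m))) ^ 2 := by
    field_simp
  have h1 : γ * m / (L * (2 + m)) ≤ c / ε := by
    rw [div_le_iff₀ (by positivity)]
    linarith
  rw [e]
  exact pow_le_pow_left₀ (by positivity) h1 2

theorem total_error_le {γ c ε d V W B K E1 E2 : ℝ} (hd : 0 ≤ d) (hV : 0 < V) (hW : 0 ≤ W)
    (hE1 : 0 ≤ E1) (hE2 : 0 ≤ E2) (hB : B ≤ Real.exp (2 * K))
    (hE : E1 * E2 ≤ Real.exp 70)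
    (h1 : γ ^ 2 * V ≤ 17 * (c / ε) ^ 2) (h2 : γ ^ 2 * W ≤ (c / ε) ^ 2) :
    γ ^ 2 * (d * (8 / (1 / V) * (B * Real.exp 1) + 32 * W * (B * E1 * E2)))
      ≤ (136 * Real.exp 1 + 32 * Real.exp 70) * Real.exp (2 * K) * (c ^ 2 * d / ε ^ 2) := by
  have h3 : B * (γ ^ 2 * V) ≤ Real.exp (2 * K) * (17 * (c / ε) ^ 2) := by gcongr
  have h4 : B * (E1 * E2) * (γ ^ 2 * W) ≤ Real.exp (2 * K) * Real.exp 70 * (c / ε) ^ 2 := by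
    gcongr
  calc _ = d * (8 * Real.exp 1 * (B * (γ ^ 2 * V)) + 32 * (B * (E1 * E2) * (γ ^ 2 * W))) := by
        rw [show (8 : ℝ) / (1 / V) = 8 * V by field_simp]
        ring
    _ ≤ d * (8 * Real.exp 1 * (Real.exp (2 * K) * (17 * (c / ε) ^ 2)) +
        32 * (Real.exp (2 * K) * Real.exp 70 * (c / ε) ^ 2)) := by gcongr
    _ = _ := by ring

/-- The accuracy bound under the inequalities that link the parameters. -/
theorem meanSquaredError_system_le_of_params {n k : ℕ} (P : Params) {ε K L : ℝ} (hε : 0 < ε)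
    (hn : 1 ≤ n) (hm : P.m ≠ 0) (hL : L = 4 * Real.log (2 + P.m))
    (hβ : P.β ≤ 1 / 2) (hK : P.β ≤ K * (1 / (n : ℝ)))
    (hLn : L * n ≤ P.m) (hLd : L * √((2 ^ k : ℕ) : ℝ) ≤ ε * P.m)
    (hγn : P.γ * √(n : ℝ) ≤ P.c / ε)
    (hγd : P.γ * √((2 ^ k : ℕ) : ℝ) ≤ P.c)
    (hγ1 : L * P.c ≤ P.γ * ε * P.m) (hγ2 : L * P.c * n ≤ P.γ * P.m * √((2 ^ k : ℕ) : ℝ))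
    (hγ3 : P.γ * P.m ≤ L * (P.c / ε) * (2 + P.m))
    (hσ : P.σ * √(n : ℝ) = 2 * (P.c + √((2 ^ k : ℕ) : ℝ) * P.γ) / ε)
    {x : Fin n → EuclideanSpace ℝ (Fin (2 ^ k))} (hx : ∀ i, ‖x i‖ ≤ P.c) :
    meanSquaredError (system P x) (∑ i, x i)
      ≤ ENNReal.ofReal ((136 * Real.exp 1 + 32 * Real.exp 70) * Real.exp (2 * K) *
          (P.c ^ 2 * ((2 ^ k : ℕ) : ℝ) / ε ^ 2)) := by
  have hn1 : (1 : ℝ) ≤ n := by exact_mod_cast hn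
  have hm1 : (1 : ℝ) ≤ P.m := by exact_mod_cast Nat.one_le_iff_ne_zero.2 hm
  have hm0 : (0 : ℝ) < P.m := by linarith
  have hL0 : 0 < L := by
    have := one_le_log_two_add hm1
    linarith
  have hd0 : (0 : ℝ) < ((2 ^ k : ℕ) : ℝ) := by positivity
  have hq2 : √((2 ^ k : ℕ) : ℝ) ^ 2 = ((2 ^ k : ℕ) : ℝ) := Real.sq_sqrt hd0.le
  have hr2 : √(n : ℝ) ^ 2 = n := Real.sq_sqrt (Nat.cast_nonneg n)
  have hq0 : 0 < √((2 ^ k : ℕ) : ℝ) := Real.sqrt_pos.2 hd0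
  have hr1 : 1 ≤ √(n : ℝ) := Real.one_le_sqrt.2 hn1
  -- The factor 4 in `L` is chosen for this: with `l = L/m` the damping is `(2 + m)⁻²`, which beats
  -- `1/l²`.
  have hexp : Real.exp (-(L / P.m * P.m / 2)) = ((2 + P.m : ℝ) ^ 2)⁻¹ := by
    rw [div_mul_cancel₀ _ hm0.ne', Real.exp_neg]
    congr 1
    rw [hL, show 4 * Real.log (2 + P.m) / 2 = ((2 : ℕ) : ℝ) * Real.log (2 + P.m) by
      push_cast; ring, Real.exp_nat_mul, Real.exp_log (by positivity)]
  have hv : ‖∑ i, x i‖ ≤ n * P.c := by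
    refine (norm_sum_le _ _).trans ((Finset.sum_le_sum fun i _ => hx i).trans_eq ?_)
    simp
  have hV0 : 0 < n * (1 + (P.σ / P.γ) ^ 2) := by positivity
  -- At `t = V ^ (-1/2)`, with `V` the variance proxy, the exponential in the deviation bound is
  -- just `e`.
  have ht0 : 0 < 1 / √(n * (1 + (P.σ / P.γ) ^ 2)) := by positivity
  have ht2 : (1 / √(n * (1 + (P.σ / P.γ) ^ 2))) ^ 2 = 1 / (n * (1 + (P.σ / P.γ) ^ 2)) := by
    rw [div_pow, one_pow, Real.sq_sqrt hV0.le]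
  have hσr : P.σ * √(n : ℝ) ≤ 4 * (P.c / ε) := by
    rw [hσ, mul_div_assoc', div_le_div_iff_of_pos_right hε]
    linarith
  have hE := noise_exponent_le hε P.γ_pos P.σ_pos hL0 hm0 hr1 hr2 hLn hLd hγ1 hσ
  have hE' := target_exponent_le P.γ_pos hL0 hm0 hq0 hq2 (norm_nonneg (∑ i, x i)) hv hγ2
  refine (meanSquaredError_system_le P hm hx ht0 (div_pos hL0 hm0)).trans
    (ENNReal.ofReal_le_ofReal ?_)
  rw [hexp]
  unfold deviationBound
  rw [ht2, one_div_mul_cancel hV0.ne', div_eq_mul_one_div 32, mul_assoc 32]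
  refine total_error_le hd0.le hV0 (by positivity)
    (Real.exp_pos _).le (Real.exp_pos _).le
    (inv_one_sub_pow_le hn P.β_nonneg hβ hK) ?_
    (gaussian_part_le P.γ_pos P.σ_pos (by linarith) hr2 hγn hσr)
    (wrap_part_le P.γ_pos hL0 hm0 hγ3)
  rw [← Real.exp_add]
  apply Real.exp_le_exp.2
  linarith

end SecSum

end

theorem theorem2 :
    ∃ (p : ℕ) (A : ℝ), 0 < A ∧ ∀ K : ℝ, 0 < K → ∃ C : ℝ, 0 < C ∧
      ∀ (n k d m : ℕ) (c ε : ℝ) (hc : 0 < c), 0 < ε → 0 < n → d = 2 ^ k →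
        A * SecSum.modulusScale n d ε * Real.log (2 + SecSum.modulusScale n d ε) ^ p ≤ (m : ℝ) →
        ∃ (γ σ : ℝ) (hγ : 0 < γ) (hσ : 0 < σ),
          SecSum.AgreeUpToLog A p m γ (c * n / (m * √(d : ℝ)) + c / (ε * m)) ∧
          SecSum.AgreeUpToLog A p m σ (c / (ε * √(n : ℝ)) + √((d : ℝ) / n) * (γ / ε)) ∧
          ∀ (β : ℝ) (hβ0 : 0 ≤ β) (hβ1 : β < 1),
            β ≤ 1 / 2 → β ≤ K * min √(γ / n) (1 / (n : ℝ)) →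
            SecSum.IsConcentratedDP (n := n) (X := EuclideanSpace ℝ (Fin (2 ^ k)))
                (1 / 2 * ε ^ 2) (SecSum.system ⟨m, c, γ, σ, β, hc, hγ, hσ, hβ0, hβ1⟩) ∧
              ∀ x : Fin n → EuclideanSpace ℝ (Fin (2 ^ k)), (∀ i, ‖x i‖ ≤ c) →
                SecSum.meanSquaredError
                    (SecSum.system ⟨m, c, γ, σ, β, hc, hγ, hσ, hβ0, hβ1⟩ x) (∑ i, x i)
                  ≤ ENNReal.ofReal (C * (c ^ 2 * d / ε ^ 2)) := by
  -- The exponent 2 and the factor 100 are those of `log_modulus_mul_le`. In `C`, `136 = 8 · 17`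
  -- comes from rounding and noise, `32 exp 70` from wrap-around with `70 = 68 + 2`, and `exp (2K)`
  -- from conditioning.
  refine ⟨2, 100, by norm_num, fun K hK =>
    ⟨(136 * Real.exp 1 + 32 * Real.exp 70) * Real.exp (2 * K), by positivity, ?_⟩⟩
  intro n k d m c ε hc hε hn hd hm
  subst hd
  have hn1 : (1 : ℝ) ≤ n := by exact_mod_cast hn
  have hd0 : (0 : ℝ) < ((2 ^ k : ℕ) : ℝ) := by positivity
  rw [SecSum.modulusScale_eq hε] at hm
  set q := √((2 ^ k : ℕ) : ℝ) with hq
  set r := √(n : ℝ) with hr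
  have hq0 : 0 < q := Real.sqrt_pos.2 hd0
  have hr1 : 1 ≤ r := Real.one_le_sqrt.2 hn1
  have hr2 : r ^ 2 = n := Real.sq_sqrt (Nat.cast_nonneg n)
  set X := (n : ℝ) + ε * n * r / q + q / ε with hX
  have hY0 : 0 < ε * n * r / q := by positivity
  have hZ0 : 0 < q / ε := by positivity
  have hX1 : 1 ≤ X := by linarith
  have hℓ := SecSum.one_le_log_two_add hX1
  have hstar := SecSum.log_modulus_mul_le hX1 hm
  have hmpos : (0 : ℝ) < m := lt_of_lt_of_le (by positivity) hm
  have hm1 : 1 ≤ m := by exact_mod_cast hmpos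
  have hm1' : (1 : ℝ) ≤ m := by exact_mod_cast hm1
  have hΛ := SecSum.one_le_log_two_add hm1'
  set L := 4 * Real.log (2 + m) with hL
  have hL0 : 0 < L := by positivity
  have hLX : L * X ≤ m := by
    refine le_trans ?_ hstar
    gcongr
    exact le_mul_of_one_le_right (by positivity) hℓ
  set g := c * n / (m * q) + c / (ε * m) with hg
  have hg0 : 0 < g := by positivity
  have hγ0 : 0 < L * g := by positivity
  have hqr : √(((2 ^ k : ℕ) : ℝ) / n) = q / r := Real.sqrt_div hd0.le _
  have hσ0 : 0 < 2 * (c / (ε * r) + q / r * (L * g / ε)) := by positivity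
  rw [hqr]
  have hgm : g * m = c * n / q + c / ε := by
    rw [hg]
    field_simp
  have hXm : X ≤ m := le_trans (le_mul_of_one_le_left (by linarith) (by linarith)) hLX
  have hγn : L * g * (ε * r) * m ≤ c * (L * X) := by
    have e : L * g * (ε * r) * m = c * (L * (ε * n * r / q + r)) := by
      calc L * g * (ε * r) * m = L * (ε * r) * (g * m) := by ring
        _ = _ := by rw [hgm]; field_simp
    rw [e]
    have : r ≤ n := by nlinarith
    gcongr
    linarith
  have hγd : L * g * q * m ≤ c * (L * X) := by
    have e : L * g * q * m = c * (L * (n + q / ε)) := by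
      calc L * g * q * m = L * q * (g * m) := by ring
        _ = _ := by rw [hgm]; field_simp
    rw [e]
    gcongr
    linarith
  have hγn' : L * g * r ≤ c / ε := by
    rw [le_div_iff₀ hε]
    have : L * g * (ε * r) * m ≤ c * m := hγn.trans (by gcongr)
    have := le_of_mul_le_mul_right this hmpos
    linarith
  have hγd' : L * g * q ≤ c := by
    have : L * g * q * m ≤ c * m := hγd.trans (by gcongr)
    exact le_of_mul_le_mul_right this hmpos
  -- the noise of a single client is wide compared with the granularity
  have hs : 2 * Real.log (2 + X) ≤ 2 * (c / (ε * r) + q / r * (L * g / ε)) / (L * g) := by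
    rw [le_div_iff₀ hγ0, mul_assoc]
    gcongr
    -- This needs the additional factor `log (2 + X)` in `hstar`; elsewhere `L X ≤ m` suffices.
    have h1 : Real.log (2 + X) * (L * g) ≤ c / (ε * r) := by
      rw [le_div_iff₀ (by positivity)]
      have h2 : Real.log (2 + X) * (L * g) * (ε * r) * m ≤ c * m := by
        calc _ = Real.log (2 + X) * (L * g * (ε * r) * m) := by ring
          _ ≤ Real.log (2 + X) * (c * (L * X)) := by gcongr
          _ = c * (L * (X * Real.log (2 + X))) := by ring
          _ ≤ c * m := by gcongr
      exact le_of_mul_le_mul_right h2 hmpos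
    have : 0 < q / r * (L * g / ε) := by positivity
    linarith
  refine ⟨L * g, 2 * (c / (ε * r) + q / r * (L * g / ε)), hγ0, hσ0, ?_, ?_, ?_⟩
  · exact SecSum.agreeUpToLog_of_eq (y := 4) (b := Real.log (2 + m)) hg0.le (by norm_num)
      (by norm_num) hm1 (by rw [hL]) hΛ le_rfl
  · exact SecSum.agreeUpToLog_of_eq (y := 2) (b := 1) (by positivity) (by norm_num)
      (by norm_num) hm1 (by ring) le_rfl hΛ
  intro β hβ0 hβ1 hβ hβK
  have hβK' : β ≤ K * (1 / (n : ℝ)) := hβK.trans (by gcongr; exact min_le_right _ _)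
  constructor
  · refine SecSum.isConcentratedDP_system _ hn ?_ ?_ ?_
    · exact le_trans (by linarith) hs
    · refine le_trans ?_ hs
      have : Real.log (2 + n) ≤ Real.log (2 + X) :=
        Real.log_le_log (by positivity) (by linarith)
      linarith
    · apply le_of_eq
      simp only
      rw [← hq, ← hr2]
      generalize L * g = γ at *
      have h1 : c / γ + q ≠ 0 := by positivity
      have e : 2 * (c / (ε * r) + q / r * (γ / ε)) / γ = 2 * (c / γ + q) / (ε * r) := by
        field_simp
      rw [e]
      field_simp
  · intro x hx
    refine SecSum.meanSquaredError_system_le_of_params _ hε hn (Nat.one_le_iff_ne_zero.1 hm1) hL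
      hβ hβK' ?_ ?_ hγn' hγd' ?_ ?_ ?_ ?_ hx
    · exact le_trans (by gcongr; linarith) hLX
    · have h1 : L * (q / ε) ≤ m := le_trans (by gcongr; linarith) hLX
      rw [mul_div_assoc', div_le_iff₀ hε] at h1
      linarith
    · calc L * c = L * (c / ε) * ε := by field_simp
        _ ≤ L * (g * m) * ε := by
          gcongr
          rw [hgm]
          have : 0 < c * n / q := by positivity
          linarith
        _ = L * g * ε * m := by ring
    · calc L * c * n = L * (c * n / q) * q := by field_simp
        _ ≤ L * (g * m) * q := by
          gcongr
          rw [hgm]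
          have : 0 < c / ε := by positivity
          linarith
        _ = L * g * m * q := by ring
    · calc L * g * m = L * (g * m) := by ring
        -- The factor `1` is written out to be compared with `r`, since `ε n r / q` is a summand of
        -- `X ≤ m`.
        _ = L * (c / ε * (ε * n * 1 / q + 1)) := by
          rw [hgm]
          field_simp
        _ ≤ L * (c / ε * (2 + m)) := by
          have h1 : ε * n * 1 / q ≤ ε * n * r / q := by gcongr
          have h2 : ε * n * 1 / q + 1 ≤ 2 + m := by linarith
          exact mul_le_mul_of_nonneg_left (mul_le_mul_of_nonneg_left h2 (by positivity)) hL0.le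
        _ = L * (c / ε) * (2 + m) := by ring
    · simp only
      rw [← hr, ← hq]
      field_simp
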